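/- An operation on $\mathbb{N}$ is a map $f:\mathbb{N}^n\to\mathbb{N}$ with $n\ge 1$. A clone is a set of operations that contains all projections and is closed under composition; it is local if for every $n$ its set of $n$-ary members is closed in $\mathbb{N}^{\mathbb{N}^n}$ (product topology, $\mathbb{N}$ discrete). Local clones are ordered by inclusion. For a set $F$ of operations, $\langle F\rangle$ is the smallest local clone containing $F$. Let $S_{\mathbb{N}}$ be the set of all permutations of $\mathbb{N}$ and $\mathcal{I}$ the set of all injections $\mathbb{N}\to\mathbb{N}$. For a monoid $M$ of maps $\mathbb{N}\to\mathbb{N}$, the monoidal interval $I_M$ is the set of all local clones whose unary members are exactly the elements of $M$, and $\mathrm{Pol}(M)$ is the set of all operations $f$ with $f(g_1,\dots,g_n)\in M$ whenever $g_1,\dots,g_n\in M$. For a set of finitary relations, $\mathrm{Pol}$ denotes the set of operations preserving all of them; $\mathrm{Inv}(F)$ is the set of finitary relations preserved by all members of $F$. A Horn formula is a quantifier-free formula in conjunctive normal form with atoms $x=y$, each clause of which has at most one positive literal. Let - $\mathcal{H}$ (the Horn clone) be the set of all operations that are injective up to fictitious variables; - $\mathcal{B}$ (the bar clone) be the local clone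 generated by $S_{\mathbb{N}}$ and any $k$-bar function, $k\ge 1$, where $f:\mathbb{N}^2\to\mathbb{N}$ is a $k$-bar function if there is an injection $p:\mathbb{N}^2\to\mathbb{N}$ with $f(x_1,x_2)=p(x_1,x_2)$ for $x_1\ge k$ and $f(x_1,x_2)=p(x_1,0)=x_1$ for $x_1<k$; - $\mathcal{R}$ be the set of all operations $f$ that are injective in one direction, i.e. for some $i$, $f(a)\ne f(b)$ whenever $a_i\neq b_i$; - $\mathcal{S}$ (the odd clone) be the local clone generated by $S_{\mathbb{N}}$ and any $f_3:\mathbb{N}^3\to\mathbb{N}$ with $f_3(x,1,1)=1$, $f_3(2,x,2)=2$, $f_3(3,3,x)=3$ for all $x$, and which at every other argument takes a value distinct from all other function values. Theorem. The smallest locally closed monoid of maps $\mathbb{N}\to\mathbb{N}$ containing $S_{\mathbb{N}}$ is $\mathcal{I}$, the smallest element of $I_{\mathcal{I}}$ is $\langle\mathcal{I}\rangle$, the definitions of $\mathcal{B}$ and $\mathcal{S}$ do not depend on the choice of the bar function and of $f_3$, and: 1. $\mathrm{Pol}(\mathcal{I})$ is the largest element of $I_{\mathcal{I}}$, and $\mathrm{Pol}(\mathcal{I})=\mathrm{Pol}(\{\neq\})$.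 2. $\mathcal{H}$ is the unique cover of $\langle\mathcal{I}\rangle$ in $I_{\mathcal{I}}$, and all elements of $I_{\mathcal{I}}$ except $\langle\mathcal{I}\rangle$ contain $\mathcal{H}$. Moreover, $\mathcal{H}$ is the local clone generated by $S_{\mathbb{N}}$ and any binary injection, and $\mathrm{Inv}(\mathcal{H})$ consists of all relations definable by a Horn formula. 3. $\mathcal{B}$ is the unique cover of $\mathcal{H}$ in $I_{\mathcal{I}}$, and all elements of $I_{\mathcal{I}}$ except $\langle\mathcal{I}\rangle$ and $\mathcal{H}$ contain $\mathcal{B}$. 4. $\mathcal{R}$ and $\mathcal{S}$ are incomparable elements of $I_{\mathcal{I}}$, and every element of $I_{\mathcal{I}}$ is either contained in $\mathcal{S}$ or contains $\mathcal{R}$. 5. The number of elements of $I_{\mathcal{I}}$ containing $\mathcal{R}$ is the continuum, and the power set of $\omega$, ordered by reverse inclusion, has an order embedding into the interval $[\mathcal{R},\mathrm{Pol}(\mathcal{I})]$ of local clones. The same (cardinality continuum, and such an order embedding) holds for $I_{\mathcal{I}}$ and for the set of all local clones containing $S_{\mathbb{N}}$. -/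

import Mathlib

namespace EqClone

/-- Finitary operations on `ℕ`, together with their arity. Only operations of arity at least one
belong to clones (see `IsClone`). -/
abbrev Op : Type := Σ n : ℕ, ((Fin n → ℕ) → ℕ)

/-- Finitary relations on `ℕ`, together with their arity. -/
abbrev Rel : Type := Σ m : ℕ, Set (Fin m → ℕ)

/-- The `n`-ary fragment of a set of operations. -/
def fragment (C : Set Op) (n : ℕ) : Set ((Fin n → ℕ) → ℕ) := {f | (⟨n, f⟩ : Op) ∈ C}

/-- Clones: sets of operations of positive arity that contain all projections and are closed
under composition. -/
structure IsClone (C : Set Op) : Prop where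
  pos : ∀ f ∈ C, 1 ≤ f.1
  proj : ∀ (n : ℕ) (k : Fin n), (fun x : Fin n → ℕ => x k) ∈ fragment C n
  comp : ∀ (n m : ℕ) (f : (Fin n → ℕ) → ℕ) (g : Fin n → (Fin m → ℕ) → ℕ),
    f ∈ fragment C n → (∀ i, g i ∈ fragment C m) →
      (fun x : Fin m → ℕ => f (fun i => g i x)) ∈ fragment C m

/-- Local clones: every `n`-ary fragment is closed in the product topology, `ℕ` being discrete. -/
structure IsLocalClone (C : Set Op) : Prop extends IsClone C where
  closed : ∀ n : ℕ, IsClosed (fragment C n)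

/-- The smallest local clone containing a given set of operations (of positive arity). -/
def cl (F : Set Op) : Set Op := ⋂₀ {C | IsLocalClone C ∧ F ⊆ C}

/-- A function `ℕ → ℕ` as a unary operation. -/
def unaryOp (g : ℕ → ℕ) : Op := ⟨1, fun x => g (x 0)⟩

/-- The unary operations of `C`, as functions `ℕ → ℕ`. -/
def unaryPart (C : Set Op) : Set (ℕ → ℕ) := {g | unaryOp g ∈ C}

/-- The set of all permutations of `ℕ`. -/
def perms : Set (ℕ → ℕ) := {g | Function.Bijective g}

/-- The set of all injections of `ℕ` into itself. -/
def injections : Set (ℕ → ℕ) := {g | Function.Injective g}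

/-- The local clone generated by an operation together with all permutations. -/
def gen (f : Op) : Set Op := cl ({f} ∪ unaryOp '' perms)

/-- Locally closed transformation monoids on `ℕ`. -/
structure IsLocalMonoid (M : Set (ℕ → ℕ)) : Prop where
  one : id ∈ M
  comp : ∀ f ∈ M, ∀ g ∈ M, f ∘ g ∈ M
  closed : IsClosed M

/-- The monoidal interval of `M`: all local clones whose unary fragment is `M`. -/
def monoidalInterval (M : Set (ℕ → ℕ)) : Set (Set Op) := {C | IsLocalClone C ∧ unaryPart C = M}

/-- All operations `f` such that `f(g₁, …, gₙ) ∈ M` whenever `g₁, …, gₙ ∈ M`. -/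
def polMonoid (M : Set (ℕ → ℕ)) : Set Op :=
  {f | 1 ≤ f.1 ∧ ∀ g : Fin f.1 → ℕ → ℕ, (∀ i, g i ∈ M) → (fun x => f.2 (fun i => g i x)) ∈ M}

/-- The operation `f` preserves the relation `ρ`. -/
def Preserves (f : Op) (ρ : Rel) : Prop :=
  ∀ r : Fin f.1 → Fin ρ.1 → ℕ, (∀ i, r i ∈ ρ.2) → (fun j => f.2 (fun i => r i j)) ∈ ρ.2

/-- The polymorphisms of a set of relations. -/
def Pol (S : Set Rel) : Set Op := {f | 1 ≤ f.1 ∧ ∀ ρ ∈ S, Preserves f ρ}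

/-- The invariant relations of a set of operations. -/
def Inv (F : Set Op) : Set Rel := {ρ | ∀ f ∈ F, Preserves f ρ}

/-- The binary inequality relation. -/
def neqRel : Rel := ⟨2, {a | a 0 ≠ a 1}⟩

/-- A literal `x = y` (if `positive` is `true`) or `x ≠ y` (otherwise) over `m` variables. -/
structure EqLiteral (m : ℕ) where
  lhs : Fin m
  rhs : Fin m
  positive : Bool

/-- Truth of a literal under an assignment. -/
def EqLiteral.Holds {m : ℕ} (l : EqLiteral m) (a : Fin m → ℕ) : Prop :=
  if l.positive then a l.lhs = a l.rhs else a l.lhs ≠ a l.rhs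

/-- Formulas in conjunctive normal form over equality: conjunctions of clauses, where a clause is
a disjunction of literals. -/
abbrev CNF (m : ℕ) : Type := List (List (EqLiteral m))

/-- Truth of a formula in conjunctive normal form under an assignment. -/
def CNF.Holds {m : ℕ} (Φ : CNF m) (a : Fin m → ℕ) : Prop :=
  ∀ c ∈ Φ, ∃ l ∈ c, l.Holds a

/-- A formula in conjunctive normal form is Horn if each clause contains at most one positive
literal. -/
def CNF.IsHorn {m : ℕ} (Φ : CNF m) : Prop :=
  ∀ c ∈ Φ, c.countP (fun l => l.positive) ≤ 1

/-- Relations definable by a Horn formula. -/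
def HornDefinable (ρ : Rel) : Prop := ∃ Φ : CNF ρ.1, Φ.IsHorn ∧ ρ.2 = {a | Φ.Holds a}

/-- The Horn clone: operations that are injective up to fictitious variables, i.e. compositions
of an injective operation (of positive arity) with projections. -/
def hornClone : Set Op :=
  {f | ∃ (m : ℕ) (σ : Fin m → Fin f.1) (p : (Fin m → ℕ) → ℕ),
    1 ≤ m ∧ Function.Injective p ∧ f.2 = fun x => p (fun j => x (σ j))}

/-- `k`-bar functions. -/
def IsBarFunction (k : ℕ) (f : (Fin 2 → ℕ) → ℕ) : Prop :=
  ∃ p : (Fin 2 → ℕ) → ℕ, Function.Injective p ∧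
    (∀ x y, k ≤ x → f ![x, y] = p ![x, y]) ∧
    (∀ x y, x < k → f ![x, y] = p ![x, 0] ∧ p ![x, 0] = x)

/-- The bar clone: the local clone generated by the permutations and the bar functions. -/
def barClone : Set Op :=
  cl ({f | ∃ k, 1 ≤ k ∧ ∃ b, IsBarFunction k b ∧ f = ⟨2, b⟩} ∪ unaryOp '' perms)

/-- The operations that are injective in one direction. -/
def richardClone : Set Op :=
  {f | ∃ i : Fin f.1, ∀ a b : Fin f.1 → ℕ, a i ≠ b i → f.2 a ≠ f.2 b}

/-- Ternary operations `f` with `f(x,1,1) = 1`, `f(2,x,2) = 2`, `f(3,3,x) = 3` that take at every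
other argument a value distinct from all other function values. -/
def IsOddGenerator (f : (Fin 3 → ℕ) → ℕ) : Prop :=
  (∀ x, f ![x, 1, 1] = 1) ∧ (∀ x, f ![2, x, 2] = 2) ∧ (∀ x, f ![3, 3, x] = 3) ∧
  ∀ a : Fin 3 → ℕ,
    (¬ ∃ x, a = ![x, 1, 1] ∨ a = ![2, x, 2] ∨ a = ![3, 3, x]) → ∀ b, b ≠ a → f b ≠ f a

/-- The odd clone: the local clone generated by the permutations and the ternary operations
above. -/
def oddClone : Set Op :=
  cl ({f | ∃ g, IsOddGenerator g ∧ f = ⟨3, g⟩} ∪ unaryOp '' perms)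

/-- Within the partially ordered set `P`, the element `b` is the one and only cover of `a`. -/
def IsUniqueCoverIn {α : Type*} [PartialOrder α] (P : Set α) (a b : α) : Prop :=
  ∃ (ha : a ∈ P) (hb : b ∈ P), ∀ c : P, (⟨a, ha⟩ : P) ⋖ c ↔ c = ⟨b, hb⟩

/-- The set of all local clones between `A` and `B`. -/
def localInterval (A B : Set Op) : Set (Set Op) := {C | IsLocalClone C ∧ A ⊆ C ∧ C ⊆ B}

/-- The set of all local clones that contain all permutations. -/
def localClonesAbovePerms : Set (Set Op) := {C | IsLocalClone C ∧ unaryOp '' perms ⊆ C}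

end EqClone

namespace EqClone

open Function

/-! ### Local closure -/

/-! Two finite tuples with the same kernel differ by a permutation of ℕ. A local clone `C` above the
permutations is therefore determined by the kernels that its operations have on finite sets of
arguments (`mem_of_ker`), and each step of the classification asks which equivalence relations on
finitely many arguments are such kernels. The elements of the interval are exactly those `C` that
preserve inequality (`mem_monoidalInterval`).

If some member of `C` does not depend on a single variable, it yields an essentially binary
operation. This combines two tuples that separate different pairs into one that separates both, so
kernels get arbitrarily fine and `C` contains the Horn clone (`hornClone_subset`). From then on
kernels are closed under intersection (`exists_ker_eq`), and a kernel is realised as soon as each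
pair outside it can be separated by a coarser one.

A member outside the Horn clone gives a binary operation merging two points with one first
coordinate while separating two points with another. Iterated, it collapses the second variable over
prescribed values of the first, which is the kernel of a bar function (`mem_of_collapse_ker`).

The dividing line for the last dichotomy is the relation "all equal or all distinct". If all of `C`
preserves it, kernel classes are subcubes, any two of which are told apart by a coordinate constant
on both. An odd generator then acts like a majority operation, passing from two classes to any
finite number, so the odd clone consists of all operations preserving this relation and inequality
(`oddClone_eq`). If some member violates the relation, values inside one slice can be merged at
will, and `C` contains every operation injective in one direction (`richardClone_subset`).

For the continuum, each length `q ≥ 3` gets a relation attached to a `q`-cycle, preserved by all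
operations injective in one direction. For each `q` some operation violates that relation alone,
since cycles of different lengths do not embed into each other (`exists_separating_cycleOp`). Sets
of lengths thus embed, order reversed, into the local clones above `richardClone`. -/

theorem isClosed_iff_local {α : Type*} {S : Set (α → ℕ)} :
    IsClosed S ↔ ∀ f, (∀ A : Finset α, ∃ g ∈ S, ∀ a ∈ A, g a = f a) → f ∈ S := by
  constructor
  · intro hS f hf
    rw [← hS.closure_eq, mem_closure_iff]
    intro o ho hfo
    obtain ⟨I, u, hu, hsub⟩ := isOpen_pi_iff.1 ho f hfo
    obtain ⟨g, hg, hgf⟩ := hf I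
    refine ⟨g, hsub fun a ha => ?_, hg⟩
    rw [hgf a ha]
    exact (hu a ha).2
  · intro h
    refine ⟨isOpen_pi_iff.2 fun f hf => ?_⟩
    by_contra! hcon
    refine hf (h f fun A => ?_)
    obtain ⟨g, hg, hgS⟩ := Set.not_subset.1 (hcon A (fun a => {f a})
      (fun a _ => ⟨isOpen_discrete _, rfl⟩))
    exact ⟨g, not_not.1 hgS, fun a ha => hg a ha⟩

/-- The partial injection `t i ↦ s i` extends to a permutation because its domain is finite and ℕ is
not. -/
theorem exists_perm_of_ker_eq {ι : Type*} [Finite ι] (t s : ι → ℕ)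
    (h : ∀ i j, t i = t j ↔ s i = s j) :
    ∃ e : ℕ → ℕ, Bijective e ∧ ∀ i, e (t i) = s i := by
  classical
  have hex : ∀ x : Set.range t, ∃ i, t i = x := fun x => x.2
  choose r hr using hex
  let φ : Set.range t ↪ ℕ := ⟨fun x => s (r x), fun x y hxy => by
    have := (h (r x) (r y)).2 hxy
    rw [hr, hr] at this
    exact Subtype.ext this⟩
  obtain ⟨g, hg⟩ := Cardinal.extend_function_of_lt φ
    (by rw [Cardinal.mk_nat]; exact (Set.finite_range t).lt_aleph0) ⟨Equiv.refl ℕ⟩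
  refine ⟨g, g.bijective, fun i => ?_⟩
  have := hg ⟨t i, i, rfl⟩
  rw [this]
  exact (h _ _).1 (hr ⟨t i, i, rfl⟩)

theorem vec2_ker {a b a' b' : ℕ} (h01 : a = b ↔ a' = b') :
    ∀ i j, ![a, b] i = ![a, b] j ↔ ![a', b'] i = ![a', b'] j
  | 0, 0 => iff_of_true rfl rfl
  | 0, 1 => h01
  | 1, 0 => eq_comm.trans (h01.trans eq_comm)
  | 1, 1 => iff_of_true rfl rfl

theorem vec3_ker {a b c a' b' c' : ℕ} (h01 : a = b ↔ a' = b')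
    (h02 : a = c ↔ a' = c') (h12 : b = c ↔ b' = c') :
    ∀ i j, ![a, b, c] i = ![a, b, c] j ↔ ![a', b', c'] i = ![a', b', c'] j
  | 0, 0 => iff_of_true rfl rfl
  | 0, 1 => h01
  | 0, 2 => h02
  | 1, 0 => eq_comm.trans (h01.trans eq_comm)
  | 1, 1 => iff_of_true rfl rfl
  | 1, 2 => h12
  | 2, 0 => eq_comm.trans (h02.trans eq_comm)
  | 2, 1 => eq_comm.trans (h12.trans eq_comm)
  | 2, 2 => iff_of_true rfl rfl

theorem vec4_ker {a b c d a' b' c' d' : ℕ} (h01 : a = b ↔ a' = b')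
    (h02 : a = c ↔ a' = c') (h03 : a = d ↔ a' = d') (h12 : b = c ↔ b' = c')
    (h13 : b = d ↔ b' = d') (h23 : c = d ↔ c' = d') :
    ∀ i j, ![a, b, c, d] i = ![a, b, c, d] j ↔ ![a', b', c', d'] i = ![a', b', c', d'] j
  | 0, 0 => iff_of_true rfl rfl
  | 0, 1 => h01
  | 0, 2 => h02
  | 0, 3 => h03
  | 1, 0 => eq_comm.trans (h01.trans eq_comm)
  | 1, 1 => iff_of_true rfl rfl
  | 1, 2 => h12
  | 1, 3 => h13
  | 2, 0 => eq_comm.trans (h02.trans eq_comm)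
  | 2, 1 => eq_comm.trans (h12.trans eq_comm)
  | 2, 2 => iff_of_true rfl rfl
  | 2, 3 => h23
  | 3, 0 => eq_comm.trans (h03.trans eq_comm)
  | 3, 1 => eq_comm.trans (h13.trans eq_comm)
  | 3, 2 => eq_comm.trans (h23.trans eq_comm)
  | 3, 3 => iff_of_true rfl rfl

/-! ### Generated local clones -/

/-- Keeps the intersection defining `cl` from being empty, which is where positivity of arities in
`cl F` comes from. -/
theorem isLocalClone_all : IsLocalClone {f | 1 ≤ f.1} where
  pos _ h := h
  proj n k := by
    change 1 ≤ n
    have := k.2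
    omega
  comp n m f g hf hg := by
    change 1 ≤ n at hf
    exact hg ⟨0, hf⟩
  closed n := isClosed_iff_local.2 fun f hf => by
    obtain ⟨g, hg, -⟩ := hf ∅
    exact hg

theorem subset_cl (F : Set Op) : F ⊆ cl F := fun _ hf _ hC => hC.2 hf

theorem cl_subset {F C : Set Op} (hC : IsLocalClone C) (h : F ⊆ C) : cl F ⊆ C :=
  fun _ hf => hf C ⟨hC, h⟩

theorem isLocalClone_cl {F : Set Op} (hF : ∀ f ∈ F, 1 ≤ f.1) : IsLocalClone (cl F) where
  pos f hf := hf _ ⟨isLocalClone_all, hF⟩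
  proj n k _ hC := hC.1.proj n k
  comp n m f g hf hg C hC := hC.1.comp n m f g (hf C hC) fun i => hg i C hC
  closed n := isClosed_iff_local.2 fun f hf C hC =>
    isClosed_iff_local.1 (hC.1.closed n) f fun A => by
      obtain ⟨g, hg, hgA⟩ := hf A
      exact ⟨g, hg C hC, hgA⟩

theorem isLocalClone_Pol (S : Set Rel) : IsLocalClone (Pol S) where
  pos _ h := h.1
  proj n k := ⟨by change 1 ≤ n; have := k.2; omega, fun _ _ _ hr => hr k⟩
  comp n m f g hf hg := by
    have hf1 : 1 ≤ n := hf.1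
    exact ⟨(hg ⟨0, hf1⟩).1, fun ρ hρ r hr => hf.2 ρ hρ _ fun i => (hg i).2 ρ hρ r hr⟩
  closed n := isClosed_iff_local.2 fun f hf => by
    classical
    refine ⟨?_, fun ρ hρ r hr => ?_⟩
    · obtain ⟨g, hg, -⟩ := hf ∅
      exact hg.1
    · obtain ⟨g, hg, hgA⟩ := hf (Finset.univ.image fun j i => r i j)
      have := hg.2 ρ hρ r hr
      have heq : (fun j => f fun i => r i j) = fun j => g fun i => r i j := by
        funext j
        exact (hgA _ (Finset.mem_image_of_mem _ (Finset.mem_univ j))).symm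
      change (fun j => f fun i => r i j) ∈ ρ.2
      rw [heq]
      exact this

theorem Pol_anti {S T : Set Rel} (h : S ⊆ T) : Pol T ⊆ Pol S :=
  fun _ hf => ⟨hf.1, fun ρ hρ => hf.2 ρ (h hρ)⟩

theorem mem_Pol_neq {f : Op} :
    f ∈ Pol {neqRel} ↔ 1 ≤ f.1 ∧ ∀ a b : Fin f.1 → ℕ, (∀ i, a i ≠ b i) → f.2 a ≠ f.2 b := by
  constructor
  · rintro ⟨h1, h⟩
    refine ⟨h1, fun a b hab => ?_⟩
    exact h neqRel rfl (fun i => ![a i, b i]) hab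
  · rintro ⟨h1, h⟩
    refine ⟨h1, ?_⟩
    rintro _ rfl r hr
    exact h _ _ hr

/-- Local clones that contain all permutations and preserve inequality. -/
structure IsNeqClone (C : Set Op) : Prop extends IsLocalClone C where
  perms : unaryOp '' perms ⊆ C
  neq : C ⊆ Pol {neqRel}

theorem IsNeqClone.ne {C : Set Op} (hC : IsNeqClone C) {n : ℕ} {f : (Fin n → ℕ) → ℕ}
    (hf : f ∈ fragment C n) {a b : Fin n → ℕ} (hab : ∀ i, a i ≠ b i) : f a ≠ f b :=
  (mem_Pol_neq.1 (hC.neq hf)).2 a b hab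

theorem perms_subset_Pol_neq : unaryOp '' perms ⊆ Pol {neqRel} := by
  rintro _ ⟨g, hg, rfl⟩
  refine mem_Pol_neq.2 ⟨le_rfl, fun a b hab h => hab (0 : Fin 1) (hg.1 h)⟩

theorem isNeqClone_Pol_neq : IsNeqClone (Pol {neqRel}) :=
  { isLocalClone_Pol _ with perms := perms_subset_Pol_neq, neq := subset_rfl }

theorem isNeqClone_gen {f : Op} (hf : f ∈ Pol {neqRel}) : IsNeqClone (gen f) := by
  have h : {f} ∪ unaryOp '' perms ⊆ Pol {neqRel} :=
    Set.union_subset (Set.singleton_subset_iff.2 hf) perms_subset_Pol_neq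
  exact { isLocalClone_cl fun g hg => (h hg).1 with
    perms := Set.subset_union_right.trans (subset_cl _)
    neq := cl_subset (isLocalClone_Pol _) h }

theorem mem_gen_self (f : Op) : f ∈ gen f := subset_cl _ (Or.inl rfl)

theorem gen_subset {f : Op} {C : Set Op} (hC : IsLocalClone C) (hp : unaryOp '' perms ⊆ C)
    (hf : f ∈ C) : gen f ⊆ C :=
  cl_subset hC (Set.union_subset (Set.singleton_subset_iff.2 hf) hp)

/-! ### Tuples of values of operations in a clone -/

/-- The tuples of values that the `n`-ary members of `C` take at the points `P i`. -/
def tuples (C : Set Op) {n : ℕ} {ι : Type*} (P : ι → Fin n → ℕ) : Set (ι → ℕ) :=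
  {t | ∃ h ∈ fragment C n, ∀ i, h (P i) = t i}

section tuples

variable {C : Set Op} {n : ℕ} {ι : Type*} {P : ι → Fin n → ℕ}

theorem IsClone.proj_mem_tuples (hC : IsClone C) (P : ι → Fin n → ℕ) (k : Fin n) :
    (fun i => P i k) ∈ tuples C P :=
  ⟨_, hC.proj n k, fun _ => rfl⟩

theorem IsClone.op_mem_tuples (hC : IsClone C) {k : ℕ} {f : (Fin k → ℕ) → ℕ}
    (hf : f ∈ fragment C k) {r : Fin k → ι → ℕ} (hr : ∀ j, r j ∈ tuples C P) :
    (fun i => f fun j => r j i) ∈ tuples C P := by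
  choose h hh heq using hr
  refine ⟨_, hC.comp k n f h hf hh, fun i => ?_⟩
  simp only [heq]

theorem ker_mem_tuples [Finite ι] (hC : IsClone C) (hp : unaryOp '' perms ⊆ C) {t s : ι → ℕ}
    (ht : t ∈ tuples C P) (h : ∀ i j, t i = t j ↔ s i = s j) : s ∈ tuples C P := by
  obtain ⟨e, he, hes⟩ := exists_perm_of_ker_eq t s h
  have := hC.op_mem_tuples (f := fun x : Fin 1 → ℕ => e (x 0)) (hp ⟨e, he, rfl⟩)
    (r := fun _ => t) fun _ => ht
  simpa only [hes] using this

theorem mem_of_forall_tuples (hC : IsLocalClone C) {f : (Fin n → ℕ) → ℕ}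
    (h : ∀ A : Finset (Fin n → ℕ), (fun a : A => f a.1) ∈ tuples C (fun a : A => a.1)) :
    f ∈ fragment C n :=
  isClosed_iff_local.1 (hC.closed n) f fun A => by
    obtain ⟨g, hg, hgA⟩ := h A
    exact ⟨g, hg, fun a ha => hgA ⟨a, ha⟩⟩

/-- Operations whose kernel is realised on every finite set belong to the clone. -/
theorem mem_of_ker (hC : IsLocalClone C) (hp : unaryOp '' perms ⊆ C) {f : (Fin n → ℕ) → ℕ}
    (h : ∀ A : Finset (Fin n → ℕ), ∃ t ∈ tuples C (fun a : A => a.1),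
      ∀ a b : A, t a = t b ↔ f a = f b) :
    f ∈ fragment C n :=
  mem_of_forall_tuples hC fun A => by
    obtain ⟨t, ht, htf⟩ := h A
    exact ker_mem_tuples hC.toIsClone hp ht htf

end tuples

/-! ### The monoidal interval of the injections -/

theorem injections_subset {C : Set Op} (hC : IsLocalClone C) (hp : unaryOp '' perms ⊆ C) :
    unaryOp '' injections ⊆ C := by
  rintro _ ⟨g, hg, rfl⟩
  refine mem_of_ker hC hp (f := fun x : Fin 1 → ℕ => g (x 0)) fun A =>
    ⟨_, hC.toIsClone.proj_mem_tuples _ 0, fun a b => ?_⟩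
  exact hg.eq_iff.symm

theorem exists_injective_pair {a b : ℕ} (h : a ≠ b) :
    ∃ g : ℕ → ℕ, Bijective g ∧ g 0 = a ∧ g 1 = b := by
  obtain ⟨e, he, hes⟩ := exists_perm_of_ker_eq ![0, 1] ![a, b]
    (vec2_ker (by simp [h]))
  exact ⟨e, he, hes 0, hes 1⟩

/-- Two arguments that differ in every coordinate are the values at `0` and `1` of a tuple of
injections, so injectivity of all composites amounts to preserving inequality. -/
theorem mem_polMonoid_iff {f : Op} : f ∈ polMonoid injections ↔ f ∈ Pol {neqRel} := by
  rw [mem_Pol_neq]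
  refine and_congr_right fun _ => ⟨fun h a b hab hf => ?_, fun h g hg x y hxy => ?_⟩
  · choose g hg h0 h1 using fun i => exists_injective_pair (hab i)
    have := @h g (fun i => (hg i).1) 0 1 (by simp only [h0, h1]; exact hf)
    omega
  · by_contra hne
    exact h _ _ (fun i e => hne (hg i e)) hxy

theorem polMonoid_injections : polMonoid injections = Pol {neqRel} :=
  Set.ext fun _ => mem_polMonoid_iff

theorem mem_monoidalInterval {C : Set Op} :
    C ∈ monoidalInterval injections ↔ IsNeqClone C := by
  constructor
  · rintro ⟨hC, hu⟩
    refine { hC with perms := ?_, neq := fun f hf => ?_ }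
    · rintro _ ⟨g, hg, rfl⟩
      change g ∈ unaryPart C
      rw [hu]
      exact hg.1
    · rw [← mem_polMonoid_iff]
      refine ⟨hC.pos f hf, fun g hg => ?_⟩
      rw [← hu]
      refine hC.comp f.1 1 f.2 (fun i x => g i (x 0)) hf fun i => ?_
      change g i ∈ unaryPart C
      rw [hu]
      exact hg i
  · intro hC
    refine ⟨hC.toIsLocalClone, Set.Subset.antisymm (fun g hg x y hxy => ?_)
      fun g hg => injections_subset hC.toIsLocalClone hC.perms ⟨g, hg, rfl⟩⟩
    by_contra hne
    exact (mem_Pol_neq.1 (hC.neq hg)).2 (fun _ => x) (fun _ => y) (fun _ => hne) hxy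

theorem isLeast_injections :
    IsLeast {M : Set (ℕ → ℕ) | IsLocalMonoid M ∧ perms ⊆ M} injections := by
  refine ⟨⟨⟨injective_id, fun f hf g hg => hf.comp hg, ?_⟩, fun g hg => hg.1⟩, ?_⟩
  · refine isClosed_iff_local.2 fun f hf x y hxy => ?_
    obtain ⟨g, hg, hgf⟩ := hf {x, y}
    refine hg ?_
    rw [hgf x (by simp), hgf y (by simp), hxy]
  · rintro M ⟨hM, hp⟩ g hg
    refine isClosed_iff_local.1 hM.closed g fun A => ?_
    obtain ⟨e, he, heg⟩ := exists_perm_of_ker_eq (fun a : A => a.1) (fun a : A => g a.1)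
      fun a b => hg.eq_iff.symm
    exact ⟨e, hp he, fun a ha => heg ⟨a, ha⟩⟩

theorem injections_subset_Pol_neq : unaryOp '' injections ⊆ Pol {neqRel} :=
  injections_subset (isLocalClone_Pol _) perms_subset_Pol_neq

theorem isNeqClone_cl_injections : IsNeqClone (cl (unaryOp '' injections)) :=
  { isLocalClone_cl fun _ hf => (injections_subset_Pol_neq hf).1 with
    perms := (Set.image_mono fun _ hg => hg.1).trans (subset_cl _)
    neq := cl_subset (isLocalClone_Pol _) injections_subset_Pol_neq }

theorem cl_injections_subset {C : Set Op} (hC : IsNeqClone C) :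
    cl (unaryOp '' injections) ⊆ C :=
  cl_subset hC.toIsLocalClone (injections_subset hC.toIsLocalClone hC.perms)

theorem isLeast_monoidalInterval :
    IsLeast (monoidalInterval injections) (cl (unaryOp '' injections)) :=
  ⟨mem_monoidalInterval.2 isNeqClone_cl_injections,
    fun _ hC => cl_injections_subset (mem_monoidalInterval.1 hC)⟩

theorem isGreatest_monoidalInterval :
    IsGreatest (monoidalInterval injections) (polMonoid injections) := by
  rw [polMonoid_injections]
  exact ⟨mem_monoidalInterval.2 isNeqClone_Pol_neq, fun _ hC => (mem_monoidalInterval.1 hC).neq⟩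

theorem isUniqueCoverIn_of_forall {α : Type*} [PartialOrder α] {P : Set α} {a b : α} (ha : a ∈ P)
    (hb : b ∈ P) (hlt : a < b) (h : ∀ c ∈ P, a ≤ c → c ≠ a → b ≤ c) : IsUniqueCoverIn P a b := by
  refine ⟨ha, hb, fun c => ⟨fun hc => ?_, ?_⟩⟩
  · have hbc : b ≤ c.1 := h c.1 c.2 hc.1.le fun e => hc.1.ne (Subtype.ext e.symm)
    by_contra hne
    exact hc.2 (c := ⟨b, hb⟩) hlt (lt_of_le_of_ne hbc fun e => hne e.symm)
  · rintro rfl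
    refine ⟨hlt, fun d h1 h2 => ?_⟩
    exact absurd (h d.1 d.2 h1.le fun e => h1.ne (Subtype.ext e.symm)) (not_le_of_gt h2)

/-! ### The Horn clone -/

/-- In this form composition takes unions of variable sets, and for a fixed `V` membership is a
condition on pairs of arguments. -/
theorem mem_hornClone_iff {f : Op} :
    f ∈ hornClone ↔ ∃ V : Finset (Fin f.1), V.Nonempty ∧
      ∀ a b, f.2 a = f.2 b ↔ ∀ i ∈ V, a i = b i := by
  classical
  constructor
  · rintro ⟨m, σ, p, hm, hp, hf⟩
    refine ⟨Finset.univ.image σ, ⟨σ ⟨0, hm⟩, by simp⟩, fun a b => ?_⟩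
    rw [hf]
    simp only [hp.eq_iff, funext_iff, Finset.mem_image, Finset.mem_univ, true_and,
      forall_exists_index, forall_apply_eq_imp_iff]
  · rintro ⟨V, hV, h⟩
    refine ⟨V.card, fun j => V.equivFin.symm j,
      fun y => f.2 fun i => if hi : i ∈ V then y (V.equivFin ⟨i, hi⟩) else 0,
      hV.card_pos, fun y z hyz => ?_, ?_⟩
    · funext j
      have := (h _ _).1 hyz (V.equivFin.symm j) (V.equivFin.symm j).2
      simpa using this
    · funext x
      refine (h _ _).2 fun i hi => ?_
      simp [hi]

theorem isLocalClone_hornClone : IsLocalClone hornClone where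
  pos f hf := by
    obtain ⟨V, ⟨i, -⟩, -⟩ := mem_hornClone_iff.1 hf
    have := i.2
    omega
  proj n k := mem_hornClone_iff.2 ⟨{k}, by simp, fun a b => by simp⟩
  comp n m f g hf hg := by
    obtain ⟨V, ⟨i, hi⟩, hV⟩ := mem_hornClone_iff.1 hf
    choose W hW hgW using fun i => mem_hornClone_iff.1 (hg i)
    refine mem_hornClone_iff.2 ⟨V.biUnion W, ?_, fun a b => ?_⟩
    · obtain ⟨j, hj⟩ := hW i
      exact ⟨j, Finset.mem_biUnion.2 ⟨i, hi, hj⟩⟩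
    · simp only at hV hgW
      simp only [hV, hgW, Finset.mem_biUnion, forall_exists_index, and_imp]
      exact ⟨fun h j i hi hj => h i hi j hj, fun h i hi j hj => h j i hi hj⟩
  closed n := by
    -- A limit of such operations could use varying sets `V`; finiteness of the union rules out
    -- trouble.
    have : fragment hornClone n = ⋃ V ∈ {V : Finset (Fin n) | V.Nonempty},
        {f : (Fin n → ℕ) → ℕ | ∀ a b, f a = f b ↔ ∀ i ∈ V, a i = b i} := by
      ext f
      simp only [Set.mem_iUnion, Set.mem_ofPred_eq, exists_prop]
      exact mem_hornClone_iff
    rw [this]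
    refine (Set.toFinite _).isClosed_biUnion fun V _ => isClosed_iff_local.2 fun f hf a b => ?_
    obtain ⟨g, hg, hgf⟩ := hf {a, b}
    rw [← hgf a (by simp), ← hgf b (by simp)]
    exact hg a b

theorem mem_hornClone_of_injective {n : ℕ} (hn : 1 ≤ n) {f : (Fin n → ℕ) → ℕ}
    (hf : Injective f) : (⟨n, f⟩ : Op) ∈ hornClone :=
  ⟨n, id, f, hn, hf, rfl⟩

theorem isNeqClone_hornClone : IsNeqClone hornClone :=
  { isLocalClone_hornClone with
    perms := by
      rintro _ ⟨g, hg, rfl⟩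
      refine mem_hornClone_of_injective le_rfl fun x y hxy => ?_
      funext i
      rw [Fin.fin_one_eq_zero i]
      exact hg.1 hxy
    neq := fun f hf => by
      refine mem_Pol_neq.2 ⟨isLocalClone_hornClone.pos f hf, fun a b hab h => ?_⟩
      obtain ⟨V, ⟨i, hi⟩, hV⟩ := mem_hornClone_iff.1 hf
      exact hab i ((hV a b).1 h i hi) }

/-- Every operation has a set of non-fictitious variables. -/
theorem exists_support {n : ℕ} (f : (Fin n → ℕ) → ℕ) :
    ∃ V : Finset (Fin n), (∀ a b, (∀ i ∈ V, a i = b i) → f a = f b) ∧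
      ∀ i ∈ V, ∃ a b, (∀ j, j ≠ i → a j = b j) ∧ f a ≠ f b := by
  classical
  let S : Set (Finset (Fin n)) := {V | ∀ a b, (∀ i ∈ V, a i = b i) → f a = f b}
  have hS : S.Nonempty := ⟨Finset.univ, fun a b h => by rw [funext fun i => h i (by simp)]⟩
  obtain ⟨V, hV, hmin⟩ := (Set.toFinite S).exists_minimal hS
  refine ⟨V, hV, fun i hi => ?_⟩
  by_contra! hcon
  have : V.erase i ∈ S := fun a b hab => by
    rw [hcon a (update a i (b i)) fun j hj => by simp [hj]]
    refine hV _ _ fun j hj => ?_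
    by_cases hji : j = i
    · subst hji; simp
    · simp [hji, hab j (Finset.mem_erase.2 ⟨hji, hj⟩)]
  exact Finset.notMem_erase i V (hmin this (Finset.erase_subset i V) hi)

/-! ### Minimality of the Horn clone above the essentially unary operations. -/

theorem IsNeqClone.exists_support {C : Set Op} (hC : IsNeqClone C) {n : ℕ}
    {f : (Fin n → ℕ) → ℕ} (hf : f ∈ fragment C n) :
    ∃ V : Finset (Fin n), V.Nonempty ∧ (∀ a b, (∀ i ∈ V, a i = b i) → f a = f b) ∧
      ∀ i ∈ V, ∃ a b, (∀ j, j ≠ i → a j = b j) ∧ f a ≠ f b := by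
  obtain ⟨V, h1, h2⟩ := EqClone.exists_support f
  refine ⟨V, ?_, h1, h2⟩
  by_contra hV
  rw [Finset.not_nonempty_iff_eq_empty] at hV
  subst hV
  exact hC.ne hf (a := fun _ => 0) (b := fun _ => 1) (fun _ => by simp) (h1 _ _ (by simp))

/-- An operation of a clone that does not depend on a single variable yields an essentially
binary one. -/
theorem exists_essential_binary {C : Set Op} (hC : IsNeqClone C) {n : ℕ} {f : (Fin n → ℕ) → ℕ}
    (hf : f ∈ fragment C n) (h : ∀ i, ∃ a b, a i = b i ∧ f a ≠ f b) :
    ∃ g ∈ fragment C 2, (∃ b x x', g ![x, b] ≠ g ![x', b]) ∧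
      ∃ c y y', g ![c, y] ≠ g ![c, y'] := by
  classical
  obtain ⟨V, ⟨i, hi⟩, -, hV⟩ := hC.exists_support hf
  obtain ⟨a, a', haa, hfa⟩ := hV i hi
  obtain ⟨p, q, hpq, hfpq⟩ := h i
  have key : ∃ c d, f (update c i (a i)) ≠ f (update c i (a' i)) ∧ (∀ j, j ≠ i → c j ≠ d j) ∧
      f (update c i (d i)) ≠ f d := by
    by_contra! H
    have ha' : update a i (a' i) = a' := by
      funext j
      by_cases hj : j = i
      · subst hj; simp
      · simp [hj, haa j hj]
    have hKa : f (update a i (a i)) ≠ f (update a i (a' i)) := by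
      rw [update_eq_self, ha']; exact hfa
    -- This point differs from `a`, `p` and `q` in every coordinate. Dependence on `i` passes from
    -- `a` to `c`, and then `f p` and `f q` depend only on the common value `p i = q i`.
    let c : Fin n → ℕ := fun j => a j + p j + q j + 1
    have h1 : ∀ x, f (update a i x) = f (update c i x) := fun x => by
      have := H a (update c i x) hKa fun j hj => by simp only [update_of_ne hj, c]; omega
      simpa using this
    have hKc : f (update c i (a i)) ≠ f (update c i (a' i)) := by
      rw [← h1, ← h1]; exact hKa
    have hp := H c p hKc fun j _ => by simp only [c]; omega
    have hq := H c q hKc fun j _ => by simp only [c]; omega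
    rw [hpq] at hp
    exact hfpq (hp.symm.trans hq)
  obtain ⟨c, d, h1, h2, h3⟩ := key
  -- Coordinate `i` of `f` reads the first variable of the new operation; every other coordinate `j`
  -- reads a permuted second variable, with `0` sent to `c j` and `1` to `d j`.
  let P : Fin 4 → Fin 2 → ℕ := ![![a i, 0], ![a' i, 0], ![d i, 0], ![d i, 1]]
  have hr : ∀ j, (if j = i then ![a i, a' i, d i, d i] else ![c j, c j, c j, d j]) ∈
      tuples C P := by
    intro j
    split_ifs with hj
    · convert hC.proj_mem_tuples P 0 using 1
      funext k
      fin_cases k <;> rfl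
    · have h1 : ![0, 0, 0, 1] ∈ tuples C P := by
        convert hC.proj_mem_tuples P 1 using 1
        funext k
        fin_cases k <;> rfl
      have := iff_of_false (zero_ne_one (α := ℕ)) (h2 j hj)
      refine ker_mem_tuples hC.toIsClone hC.perms h1
        (vec4_ker ?_ ?_ this ?_ this this) <;> exact iff_of_true rfl rfl
  obtain ⟨g, hg, hgt⟩ := hC.op_mem_tuples hf hr
  have hu : ∀ k x, (∀ j, j ≠ i → ![c j, c j, c j, d j] k = c j) →
      ![a i, a' i, d i, d i] k = x → g (P k) = f (update c i x) := fun k x h1 h2 => by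
    rw [hgt k]
    refine congrArg f ?_
    funext j
    by_cases hj : j = i
    · subst hj; rw [if_pos rfl, update_self, h2]
    · rw [if_neg hj, update_of_ne hj, h1 j hj]
  have e0 : g ![a i, 0] = f (update c i (a i)) := hu 0 _ (fun _ _ => rfl) rfl
  have e1 : g ![a' i, 0] = f (update c i (a' i)) := hu 1 _ (fun _ _ => rfl) rfl
  have e2 : g ![d i, 0] = f (update c i (d i)) := hu 2 _ (fun _ _ => rfl) rfl
  have e3 : g ![d i, 1] = f d := (hgt 3).trans <| congrArg f <| funext fun j => by
    by_cases hj : j = i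
    · subst hj; rw [if_pos rfl]; rfl
    · rw [if_neg hj]; rfl
  refine ⟨g, hg, ⟨0, a i, a' i, ?_⟩, ⟨d i, 0, 1, ?_⟩⟩
  · rw [e0, e1]; exact h1
  · rw [e2, e3]; exact h3

/-- This is the degenerate case in which `G · b` varies only at `c`. Either some other `G x ·`
varies off `b` and replaces `G c ·`, or all of them are constant off `b`, and then preservation of
inequality forces the variation needed at `b + 1` and `c + 1`. -/
theorem exists_nonconstant_off_aux {G : ℕ → ℕ → ℕ}
    {b c : ℕ} {v : ℕ} (hv : ∀ x, x ≠ c → G x b = v) (hc : G c b ≠ v)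
    (hG : ∀ x x' y y', x ≠ x' → y ≠ y' → G x y ≠ G x' y') :
    ∃ b c, (∃ a a', a ≠ c ∧ a' ≠ c ∧ G a b ≠ G a' b) ∧
      ∃ d d', d ≠ b ∧ d' ≠ b ∧ G c d ≠ G c d' := by
  by_cases hx : ∃ x, x ≠ c ∧ ∃ d d', d ≠ b ∧ d' ≠ b ∧ G x d ≠ G x d'
  · obtain ⟨x, hxc, hd⟩ := hx
    refine ⟨b, x, ⟨c, x + c + 1, hxc.symm, by omega, ?_⟩, hd⟩
    rw [hv (x + c + 1) (by omega)]
    exact hc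
  · push Not at hx
    refine ⟨b + 1, c + 1, ⟨c + 2, c + 3, by omega, by omega, ?_⟩, ⟨b, b + 2, by omega, by omega, ?_⟩⟩
    · rw [hx (c + 2) (by omega) (b + 1) (b + 2) (by omega) (by omega)]
      exact hG _ _ _ _ (by omega) (by omega)
    · rw [hv (c + 1) (by omega), ← hv (c + 2) (by omega)]
      exact hG _ _ _ _ (by omega) (by omega)

theorem exists_nonconstant_off {G : ℕ → ℕ → ℕ}
    (hG : ∀ x x' y y', x ≠ x' → y ≠ y' → G x y ≠ G x' y')
    (h1 : ∃ b x x', G x b ≠ G x' b) (h2 : ∃ c y y', G c y ≠ G c y') :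
    ∃ b c, (∃ a a', a ≠ c ∧ a' ≠ c ∧ G a b ≠ G a' b) ∧
      ∃ d d', d ≠ b ∧ d' ≠ b ∧ G c d ≠ G c d' := by
  obtain ⟨b, x, x', hx⟩ := h1
  obtain ⟨c, y, y', hy⟩ := h2
  by_cases hA : ∃ a a', a ≠ c ∧ a' ≠ c ∧ G a b ≠ G a' b
  · by_cases hB : ∃ d d', d ≠ b ∧ d' ≠ b ∧ G c d ≠ G c d'
    · exact ⟨b, c, hA, hB⟩
    · push Not at hB
      have hv : ∀ z, z ≠ b → G c z = G c (b + 1) := fun z hz => hB z (b + 1) hz (by omega)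
      have hne : G c b ≠ G c (b + 1) := by
        intro e
        have hall : ∀ z, G c z = G c (b + 1) := fun z => by
          by_cases hz : z = b
          · rw [hz, e]
          · exact hv z hz
        exact hy ((hall y).trans (hall y').symm)
      obtain ⟨b', c', h1, h2⟩ := exists_nonconstant_off_aux (G := fun y x => G x y) hv hne
        fun x x' y y' hx hy => hG y y' x x' hy hx
      exact ⟨c', b', h2, h1⟩
  · push Not at hA
    have hv : ∀ z, z ≠ c → G z b = G (c + 1) b := fun z hz => hA z (c + 1) hz (by omega)
    refine exists_nonconstant_off_aux hv (fun e => ?_) hG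
    have hall : ∀ z, G z b = G (c + 1) b := fun z => by
      by_cases hz : z = c
      · rw [hz, e]
      · exact hv z hz
    exact hx ((hall x).trans (hall x').symm)

/-- As `φ` takes two values off `c`, one of them differs from `φ c`; this settles the cases `u = x`
and `u = y`, where `c` itself must be one of the separated points. -/
theorem exists_perm_separating {φ : ℕ → ℕ} {x y u c a a' : ℕ} (hxy : x ≠ y) (ha : a ≠ c)
    (ha' : a' ≠ c) (hφ : φ a ≠ φ a') :
    ∃ e : ℕ → ℕ, Bijective e ∧ e u = c ∧ φ (e x) ≠ φ (e y) := by
  have haa : a ≠ a' := fun e => hφ (by rw [e])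
  have pair : ∀ {x y}, x ≠ y → ∃ e : ℕ → ℕ, Bijective e ∧ e x = c ∧ φ (e x) ≠ φ (e y) := by
    intro x y hxy
    obtain ⟨a'', h1, h2⟩ : ∃ a'', a'' ≠ c ∧ φ c ≠ φ a'' := by
      by_cases h : φ c = φ a
      · exact ⟨a', ha', by rw [h]; exact hφ⟩
      · exact ⟨a, ha, h⟩
    obtain ⟨e, he, hes⟩ := exists_perm_of_ker_eq ![x, y] ![c, a'']
      (vec2_ker (iff_of_false hxy h1.symm))
    have e0 : e x = c := hes 0
    have e1 : e y = a'' := hes 1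
    exact ⟨e, he, e0, by rw [e0, e1]; exact h2⟩
  by_cases hux : x = u
  · subst hux
    exact pair hxy
  by_cases huy : y = u
  · subst huy
    obtain ⟨e, he, h1, h2⟩ := pair hxy.symm
    exact ⟨e, he, h1, h2.symm⟩
  obtain ⟨e, he, hes⟩ := exists_perm_of_ker_eq ![x, y, u] ![a, a', c]
    (vec3_ker (iff_of_false hxy haa) (iff_of_false hux ha) (iff_of_false huy ha'))
  have e0 : e x = a := hes 0
  have e1 : e y = a' := hes 1
  have e2 : e u = c := hes 2
  exact ⟨e, he, e2, by rw [e0, e1]; exact hφ⟩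

theorem perm_mem_tuples {C : Set Op} (hC : IsNeqClone C) {n : ℕ} {ι : Type*}
    {P : ι → Fin n → ℕ} {t : ι → ℕ} (ht : t ∈ tuples C P) {e : ℕ → ℕ} (he : Bijective e) :
    (fun i => e (t i)) ∈ tuples C P :=
  hC.op_mem_tuples (f := fun x : Fin 1 → ℕ => e (x 0)) (hC.perms ⟨e, he, rfl⟩)
    (r := fun _ => t) fun _ => ht

theorem binary_mem_tuples {C : Set Op} (hC : IsClone C) {n : ℕ} {ι : Type*}
    {P : ι → Fin n → ℕ} {g : (Fin 2 → ℕ) → ℕ} (hg : g ∈ fragment C 2) {t s : ι → ℕ}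
    (ht : t ∈ tuples C P) (hs : s ∈ tuples C P) :
    (fun i => g ![t i, s i]) ∈ tuples C P := by
  have := hC.op_mem_tuples hg (r := ![t, s]) fun j => by fin_cases j <;> assumption
  convert this using 3 with i
  funext j
  fin_cases j <;> rfl

/-- In the essential case `s` merges `i, j` and `t` merges `k, l`. Permutations move the merged
values to `b` and `c`, where `g` still varies in its other variable; pairs separated by both tuples
stay apart because `g` preserves inequality. -/
theorem exists_separating_both {C : Set Op} (hC : IsNeqClone C) {g : (Fin 2 → ℕ) → ℕ}
    (hg : g ∈ fragment C 2) (hg1 : ∃ b x x', g ![x, b] ≠ g ![x', b])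
    (hg2 : ∃ c y y', g ![c, y] ≠ g ![c, y']) {n : ℕ} {ι : Type*} {P : ι → Fin n → ℕ}
    {t s : ι → ℕ} (ht : t ∈ tuples C P) (hs : s ∈ tuples C P) {i j k l : ι} (hij : t i ≠ t j)
    (hkl : s k ≠ s l) :
    ∃ r ∈ tuples C P, r i ≠ r j ∧ r k ≠ r l ∧ ∀ p q, t p ≠ t q → s p ≠ s q → r p ≠ r q := by
  by_cases hij' : s i = s j
  swap
  · exact ⟨s, hs, hij', hkl, fun _ _ _ h => h⟩
  by_cases hkl' : t k = t l
  swap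
  · exact ⟨t, ht, hij, hkl', fun _ _ h _ => h⟩
  have hG : ∀ x x' y y', x ≠ x' → y ≠ y' → g ![x, y] ≠ g ![x', y'] := fun x x' y y' hx hy =>
    hC.ne hg fun i => by fin_cases i <;> assumption
  obtain ⟨b, c, ⟨a, a', h1, h2, h3⟩, ⟨d, d', h4, h5, h6⟩⟩ :=
    exists_nonconstant_off (G := fun x y => g ![x, y]) hG hg1 hg2
  obtain ⟨α, hα, hαc, hαn⟩ := exists_perm_separating (φ := fun x => g ![x, b]) (u := t k) hij
    h1 h2 h3
  obtain ⟨β, hβ, hβb, hβn⟩ := exists_perm_separating (φ := fun y => g ![c, y]) (u := s i) hkl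
    h4 h5 h6
  refine ⟨_, binary_mem_tuples hC.toIsClone hg (perm_mem_tuples hC ht hα)
    (perm_mem_tuples hC hs hβ), ?_, ?_, fun p q hp hq =>
      hG _ _ _ _ (hα.1.ne hp) (hβ.1.ne hq)⟩
  · rw [← hij', hβb]
    exact hαn
  · rw [← hkl', hαc]
    exact hβn

theorem exists_separating_finset {C : Set Op} (hC : IsNeqClone C) {g : (Fin 2 → ℕ) → ℕ}
    (hg : g ∈ fragment C 2) (hg1 : ∃ b x x', g ![x, b] ≠ g ![x', b])
    (hg2 : ∃ c y y', g ![c, y] ≠ g ![c, y']) {n : ℕ} (hn : 1 ≤ n) {ι : Type*}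
    {P : ι → Fin n → ℕ} (hP : Injective P) (S : Finset (ι × ι)) (hS : ∀ p ∈ S, p.1 ≠ p.2) :
    ∃ t ∈ tuples C P, ∀ p ∈ S, t p.1 ≠ t p.2 := by
  classical
  induction hk : S.card using Nat.strong_induction_on generalizing S with
  | _ k ih =>
    subst hk
    rcases S.eq_empty_or_nonempty with rfl | ⟨s, hs⟩
    · exact ⟨_, hC.proj_mem_tuples P ⟨0, hn⟩, by simp⟩
    rcases (S.erase s).eq_empty_or_nonempty with he | ⟨s', hs'⟩
    · obtain ⟨k, hk⟩ := Function.ne_iff.1 (hP.ne (hS s hs))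
      refine ⟨_, hC.proj_mem_tuples P k, fun p hp => ?_⟩
      by_cases hps : p = s
      · rw [hps]; exact hk
      · have : p ∈ S.erase s := Finset.mem_erase.2 ⟨hps, hp⟩
        simp [he] at this
    · have hs'S := Finset.mem_of_mem_erase hs'
      -- Of the pairs in `S`, the tuple `t` may merge only `s` and `r` may merge only `s'`, so each
      -- repairs the other.
      obtain ⟨t, ht, htS⟩ := ih _ (Finset.card_erase_lt_of_mem hs) (S.erase s)
        (fun p hp => hS p (Finset.mem_of_mem_erase hp)) rfl
      obtain ⟨r, hr, hrS⟩ := ih _ (Finset.card_erase_lt_of_mem hs'S) (S.erase s')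
        (fun p hp => hS p (Finset.mem_of_mem_erase hp)) rfl
      obtain ⟨q, hq, h1, h2, h3⟩ := exists_separating_both hC hg hg1 hg2 ht hr (htS s' hs')
        (hrS s (Finset.mem_erase.2 ⟨(Finset.ne_of_mem_erase hs').symm, hs⟩))
      refine ⟨q, hq, fun p hp => ?_⟩
      by_cases hps : p = s
      · rw [hps]; exact h2
      by_cases hps' : p = s'
      · rw [hps']; exact h1
      exact h3 _ _ (htS p (Finset.mem_erase.2 ⟨hps, hp⟩)) (hrS p (Finset.mem_erase.2 ⟨hps', hp⟩))

/-- A clone with an operation that does not depend on a single variable contains every injective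
operation up to fictitious variables. -/
theorem hornClone_subset {C : Set Op} (hC : IsNeqClone C) {n : ℕ} {f : (Fin n → ℕ) → ℕ}
    (hf : f ∈ fragment C n) (h : ∀ i, ∃ a b, a i = b i ∧ f a ≠ f b) : hornClone ⊆ C := by
  classical
  obtain ⟨g, hg, hg1, hg2⟩ := exists_essential_binary hC hf h
  rintro ⟨k, q⟩ ⟨m, σ, p, hm, hp, hq⟩
  have hpC : p ∈ fragment C m := mem_of_ker hC.toIsLocalClone hC.perms fun A => by
    obtain ⟨t, ht, hts⟩ := exists_separating_finset hC hg hg1 hg2 hm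
      (P := fun a : A => a.1) Subtype.val_injective (Finset.univ.filter fun p : A × A => p.1 ≠ p.2)
      (by simp)
    refine ⟨t, ht, fun a b => ?_⟩
    rw [hp.eq_iff]
    constructor
    · intro hab
      by_contra hne
      exact hts (a, b) (by simpa using fun e => hne (by rw [e])) hab
    · intro e
      rw [Subtype.ext e]
  have := hC.comp m k p _ hpC fun j => hC.proj k (σ j)
  rwa [← show q = _ from hq] at this

theorem hornClone_subset_of_not_subset {C : Set Op} (hC : IsNeqClone C)
    (h : ¬ C ⊆ cl (unaryOp '' injections)) : hornClone ⊆ C := by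
  obtain ⟨⟨n, f⟩, hf, hfn⟩ := Set.not_subset.1 h
  refine hornClone_subset hC hf fun i => ?_
  by_contra! hcon
  refine hfn ?_
  have hinj : (fun x => f fun _ => x) ∈ injections := fun x y hxy => by
    by_contra hne
    exact hC.ne hf (fun _ => hne) hxy
  have hU := isNeqClone_cl_injections
  have := hU.comp 1 n (fun x => f fun _ => x 0) (fun _ x => x i) (subset_cl _ ⟨_, hinj, rfl⟩)
    fun _ => hU.proj n i
  have he : (fun x : Fin n → ℕ => f fun _ => x i) = f := by
    funext x
    exact hcon _ _ rfl
  rw [he] at this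
  exact this

/-- The relation `x = y ∨ u = v`. -/
def orEqRel : Rel := ⟨4, {a | a 0 = a 1 ∨ a 2 = a 3}⟩

/-- Binary injections violate this relation, so the Horn clone lies strictly above the least
element. -/
theorem cl_injections_subset_Pol_orEqRel : cl (unaryOp '' injections) ⊆ Pol {orEqRel} := by
  refine cl_subset (isLocalClone_Pol _) ?_
  rintro _ ⟨g, hg, rfl⟩
  refine ⟨le_rfl, ?_⟩
  rintro _ rfl r hr
  rcases hr (0 : Fin 1) with h | h
  · exact Or.inl (congrArg g h)
  · exact Or.inr (congrArg g h)

theorem notMem_Pol_orEqRel {p : (Fin 2 → ℕ) → ℕ} (hp : Injective p) :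
    (⟨2, p⟩ : Op) ∉ Pol {orEqRel} := by
  intro h
  have := h.2 orEqRel rfl ![![0, 1, 0, 0], ![0, 0, 0, 1]] fun i => by
    fin_cases i
    · exact Or.inr rfl
    · exact Or.inl rfl
  rcases this with h | h
  · exact zero_ne_one (show (0 : ℕ) = 1 from congrFun (hp h) (0 : Fin 2))
  · exact zero_ne_one (show (0 : ℕ) = 1 from congrFun (hp h) (1 : Fin 2))

theorem pair_injective : Injective fun x : Fin 2 → ℕ => Nat.pair (x 0) (x 1) := by
  intro x y h
  have := Nat.pair_eq_pair.1 h
  funext i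
  fin_cases i
  · exact this.1
  · exact this.2

theorem gen_injective {p : (Fin 2 → ℕ) → ℕ} (hp : Injective p) : gen ⟨2, p⟩ = hornClone := by
  have hpH := mem_hornClone_of_injective (by norm_num) hp
  refine Set.Subset.antisymm
    (gen_subset isLocalClone_hornClone isNeqClone_hornClone.perms hpH)
    (hornClone_subset_of_not_subset (isNeqClone_gen (isNeqClone_hornClone.neq hpH)) fun h =>
      notMem_Pol_orEqRel hp (cl_injections_subset_Pol_orEqRel (h (mem_gen_self _))))

theorem hornClone_not_subset : ¬ hornClone ⊆ cl (unaryOp '' injections) := fun h =>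
  notMem_Pol_orEqRel pair_injective (cl_injections_subset_Pol_orEqRel
    (h (mem_hornClone_of_injective (by norm_num) pair_injective)))

theorem hornClone_subset_of_ne {C : Set Op} (hC : IsNeqClone C)
    (h : C ≠ cl (unaryOp '' injections)) : hornClone ⊆ C :=
  hornClone_subset_of_not_subset hC fun hs => h (hs.antisymm (cl_injections_subset hC))

theorem isUniqueCoverIn_hornClone :
    IsUniqueCoverIn (monoidalInterval injections) (cl (unaryOp '' injections)) hornClone :=
  isUniqueCoverIn_of_forall (mem_monoidalInterval.2 isNeqClone_cl_injections)
    (mem_monoidalInterval.2 isNeqClone_hornClone)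
    (lt_of_le_not_ge (cl_injections_subset isNeqClone_hornClone) hornClone_not_subset)
    fun _ hC _ hne => hornClone_subset_of_ne (mem_monoidalInterval.1 hC) hne

/-! ### Horn definability -/

theorem eq_of_countP_le_one {α : Type*} {p : α → Bool} {l : List α} (h : l.countP p ≤ 1) {x y : α}
    (hx : x ∈ l) (hy : y ∈ l) (hpx : p x) (hpy : p y) : x = y := by
  rw [List.countP_eq_length_filter] at h
  have hx' := List.mem_filter.2 ⟨hx, hpx⟩
  have hy' := List.mem_filter.2 ⟨hy, hpy⟩
  match l.filter p, h, hx', hy' with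
  | [z], _, hx', hy' => rw [List.mem_singleton.1 hx', List.mem_singleton.1 hy']

/-- Suppose the value tuple violates a clause. The equalities denied by the negative literals then
hold in every essential row, so every such row satisfies the unique positive literal, and with them
the value tuple does too. -/
theorem hornDefinable_subset : {ρ | HornDefinable ρ} ⊆ Inv hornClone := by
  rintro ⟨m, R⟩ ⟨Φ, hΦ, hR⟩ f hf r hr
  obtain ⟨V, ⟨i, hi⟩, hV⟩ := mem_hornClone_iff.1 hf
  have hr : ∀ i, Φ.Holds (r i) := fun i => (Set.ext_iff.1 hR _).1 (hr i)
  refine (Set.ext_iff.1 hR _).2 fun c hc => ?_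
  by_contra! hcon
  have hpos : ∀ j ∈ V, ∃ l ∈ c, l.positive = true ∧ r j l.lhs = r j l.rhs := fun j hj => by
    obtain ⟨l, hl, hlr⟩ := hr j c hc
    have hlt := hcon l hl
    unfold EqLiteral.Holds at hlr hlt
    cases hlp : l.positive
    · simp only [hlp, Bool.false_eq_true, if_false, ne_eq, not_not] at hlr hlt
      exact absurd ((hV _ _).1 hlt j hj) hlr
    · rw [hlp, if_pos rfl] at hlr
      exact ⟨l, hl, hlp, hlr⟩
  obtain ⟨l, hl, hlp, -⟩ := hpos i hi
  have hlt := hcon l hl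
  simp only [EqLiteral.Holds, hlp, if_true] at hlt
  rw [hV] at hlt
  push Not at hlt
  obtain ⟨j, hj, hjne⟩ := hlt
  obtain ⟨l', hl', hlp', he⟩ := hpos j hj
  rw [eq_of_countP_le_one (hΦ c hc) hl' hl hlp' hlp] at he
  exact hjne he

/-- The Horn clause whose negative literals are given by `c.1` and whose positive literal, if
any, is given by `c.2`. -/
noncomputable def hornClause {m : ℕ} (c : Finset (Fin m × Fin m) × Option (Fin m × Fin m)) :
    List (EqLiteral m) :=
  c.1.toList.map (fun p => ⟨p.1, p.2, false⟩) ++ c.2.toList.map fun p => ⟨p.1, p.2, true⟩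

theorem hornClause_countP {m : ℕ} (c : Finset (Fin m × Fin m) × Option (Fin m × Fin m)) :
    (hornClause c).countP (fun l => l.positive) ≤ 1 := by
  rw [hornClause, List.countP_append, List.countP_map, List.countP_map]
  rcases c with ⟨K, _ | p⟩ <;> simp [Function.comp_def]

theorem hornClause_holds {m : ℕ} {c : Finset (Fin m × Fin m) × Option (Fin m × Fin m)}
    {a : Fin m → ℕ} : (∃ l ∈ hornClause c, l.Holds a) ↔
      (∃ p ∈ c.1, a p.1 ≠ a p.2) ∨ ∃ p ∈ c.2, a p.1 = a p.2 := by
  simp only [hornClause, List.mem_append, List.mem_map, Finset.mem_toList, Option.mem_toList,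
    or_and_right, exists_or, EqLiteral.Holds]
  constructor
  · rintro (⟨l, ⟨p, hp, rfl⟩, hl⟩ | ⟨l, ⟨p, hp, rfl⟩, hl⟩)
    · exact Or.inl ⟨p, hp, hl⟩
    · exact Or.inr ⟨p, hp, hl⟩
  · rintro (⟨p, hp, hl⟩ | ⟨p, hp, hl⟩)
    · exact Or.inl ⟨_, ⟨p, hp, rfl⟩, hl⟩
    · exact Or.inr ⟨_, ⟨p, hp, rfl⟩, hl⟩

theorem Inv_hornClone_subset : Inv hornClone ⊆ {ρ | HornDefinable ρ} := by
  classical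
  rintro ⟨m, R⟩ hρ
  have hker : ∀ t ∈ R, ∀ s : Fin m → ℕ, (∀ i j, t i = t j ↔ s i = s j) → s ∈ R := by
    intro t ht s hts
    obtain ⟨e, he, hes⟩ := exists_perm_of_ker_eq t s hts
    have : (fun j => e (t j)) ∈ R :=
      hρ _ (isNeqClone_hornClone.perms ⟨e, he, rfl⟩) (fun _ => t) fun _ => ht
    simpa only [hes] using this
  have hpair : ∀ t ∈ R, ∀ s ∈ R, (fun j => Nat.pair (t j) (s j)) ∈ R := fun t ht s hs =>
    hρ _ (mem_hornClone_of_injective (by norm_num) pair_injective) ![t, s] fun i => by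
      fin_cases i <;> assumption
  let Cl := {c : Finset (Fin m × Fin m) × Option (Fin m × Fin m) |
    ∀ t ∈ R, ∃ l ∈ hornClause c, l.Holds t}
  refine ⟨(Finset.univ.filter (· ∈ Cl)).toList.map hornClause, ?_, ?_⟩
  · intro c hc
    obtain ⟨d, -, rfl⟩ := List.mem_map.1 hc
    exact hornClause_countP d
  refine Set.Subset.antisymm (fun a ha c hc => ?_) fun a ha => ?_
  · obtain ⟨d, hd, rfl⟩ := List.mem_map.1 hc
    exact (Finset.mem_filter.1 (Finset.mem_toList.1 hd)).2 a ha
  have ha' : ∀ d ∈ Cl, ∃ l ∈ hornClause d, l.Holds a := fun d hd =>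
    ha _ (List.mem_map.2 ⟨d, by simpa using hd, rfl⟩)
  let K : Finset (Fin m × Fin m) := Finset.univ.filter fun p => a p.1 = a p.2
  have hK : ∀ p ∈ K, a p.1 = a p.2 := fun p hp => (Finset.mem_filter.1 hp).2
  let S := {t ∈ R | ∀ p ∈ K, t p.1 = t p.2}
  have hS : S.Nonempty := by
    by_contra hS
    -- If `S` were empty, the purely negative clause over `K` would hold throughout `R`, yet `a`
    -- violates it.
    rcases hornClause_holds.1 (ha' (K, none) fun t ht => hornClause_holds.2 <| Or.inl <| by
      by_contra! h
      exact hS ⟨t, ht, h⟩) with ⟨p, hp, h⟩ | ⟨p, hp, -⟩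
    · exact h (hK p hp)
    · simp at hp
  obtain ⟨t, ⟨htR, htK⟩, hmin⟩ := (measure fun t : Fin m → ℕ =>
    (Finset.univ.filter fun p : Fin m × Fin m => t p.1 = t p.2).card).wf.has_min S hS
  refine hker t htR a fun i j => ⟨fun hij => ?_, fun hij => htK (i, j) (by simpa [K] using hij)⟩
  -- A tuple of `R` violating this clause could be paired with `t` to leave fewer equalities,
  -- against minimality.
  have hcl : (K, some (i, j)) ∈ Cl := fun s hs => hornClause_holds.2 <| by
    by_contra! h
    refine hmin _ ⟨hpair t htR s hs, fun p hp => by simp only [htK p hp, h.1 p hp]⟩ ?_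
    refine Finset.card_lt_card (Finset.ssubset_iff_of_subset (fun p => ?_) |>.2 ⟨(i, j), ?_, ?_⟩)
    · simp only [Finset.mem_filter, Finset.mem_univ, true_and, Nat.pair_eq_pair]
      exact fun h => h.1
    · simpa using hij
    · simpa [Nat.pair_eq_pair, hij] using h.2
  rcases hornClause_holds.1 (ha' _ hcl) with ⟨p, hp, h⟩ | ⟨p, hp, h⟩
  · exact absurd (hK p hp) h
  · obtain rfl : (i, j) = p := by simpa using hp
    exact h

theorem Inv_hornClone : Inv hornClone = {ρ | HornDefinable ρ} :=
  Inv_hornClone_subset.antisymm hornDefinable_subset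

/-! ### The bar clone -/

/-- A clone that is not contained in the Horn clone has a binary operation that identifies two
arguments with first coordinate `0` and separates two arguments with first coordinate `1`. -/
theorem exists_binary_of_notMem_hornClone {C : Set Op} (hC : IsNeqClone C) {n : ℕ}
    {f : (Fin n → ℕ) → ℕ} (hf : f ∈ fragment C n) (hfn : (⟨n, f⟩ : Op) ∉ hornClone) :
    ∃ g ∈ fragment C 2, g ![0, 0] = g ![0, 1] ∧ g ![1, 2] ≠ g ![1, 3] := by
  classical
  obtain ⟨V, hVne, hV, hVdep⟩ := hC.exists_support hf
  obtain ⟨a, b, hab, i, hi, habi⟩ : ∃ a b, f a = f b ∧ ∃ i ∈ V, a i ≠ b i := by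
    by_contra! hcon
    exact hfn (mem_hornClone_iff.2 ⟨V, hVne, fun a b => ⟨hcon a b, hV a b⟩⟩)
  obtain ⟨c, c', hcc, hfc⟩ := hVdep i hi
  have key : ∃ p q r s : Fin n → ℕ, f p = f q ∧ f r ≠ f s ∧
      ∀ j, (p j = q j ∧ r j = s j ∧ p j ≠ r j) ∨
        (p j ≠ q j ∧ p j ≠ r j ∧ p j ≠ s j ∧ q j ≠ r j ∧ q j ≠ s j ∧ r j ≠ s j) := by
    by_contra! H
    -- `N` bounds all values in play, so `N + 1`, `N + 2`, `N + 3` are fresh. Applying `H` to `a, b,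
    -- r, s` replaces the merged pair by the fresh pair `r, s`; applying it to `r, s, d, w` then
    -- gives `c` and `c'` the common value `f w`.
    let N : Fin n → ℕ := fun j => a j + b j + c j + c' j
    let r : Fin n → ℕ := fun j => N j + 1
    let s : Fin n → ℕ := fun j => if a j = b j then N j + 1 else N j + 2
    let w : Fin n → ℕ := fun j => if a j = b j then c j else N j + 3
    have h1 : f r = f s := by
      by_contra hne
      obtain ⟨j, hj1, hj2⟩ := H a b r s hab hne
      by_cases h : a j = b j
      · exact absurd (hj1 h (by simp [r, s, h])) (by simp only [r, N]; omega)
      · simp only [r, s, N, h, if_false] at hj2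
        omega
    have h2 : ∀ d : Fin n → ℕ, (∀ j, a j = b j → d j = c j) → (∀ j, d j ≤ N j) →
        f d = f w := by
      intro d hd hdN
      by_contra hne
      obtain ⟨j, hj1, hj2⟩ := H r s d w h1 hne
      have := hdN j
      by_cases h : a j = b j
      · simp only [r, s, w, h, if_true, hd j h] at hj1
        have := hd j h
        exact absurd (hj1 trivial trivial) (by omega)
      · simp only [r, s, w, h, if_false] at hj2
        omega
    refine hfc ((h2 c (fun _ _ => rfl) fun j => by simp only [N]; omega).trans
      (h2 c' (fun j hj => (hcc j ?_).symm) fun j => by simp only [N]; omega).symm)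
    rintro rfl
    exact habi hj
  obtain ⟨p, q, r, s, hpq, hrs, hj⟩ := key
  let P : Fin 4 → Fin 2 → ℕ := ![![0, 0], ![0, 1], ![1, 2], ![1, 3]]
  have hP0 : ![0, 0, 1, 1] ∈ tuples C P := by
    convert hC.proj_mem_tuples P 0 using 1
    funext k
    fin_cases k <;> rfl
  have hP1 : ![0, 1, 2, 3] ∈ tuples C P := by
    convert hC.proj_mem_tuples P 1 using 1
    funext k
    fin_cases k <;> rfl
  have hr : ∀ j, ![p j, q j, r j, s j] ∈ tuples C P := fun j => by
    rcases hj j with ⟨h1, h2, h3⟩ | ⟨h1, h2, h3, h4, h5, h6⟩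
    · have h0 := iff_of_false (zero_ne_one (α := ℕ)) h3
      rw [← h1, ← h2]
      exact ker_mem_tuples hC.toIsClone hC.perms hP0
        (vec4_ker (iff_of_true rfl rfl) h0 h0 h0 h0 (iff_of_true rfl rfl))
    · exact ker_mem_tuples hC.toIsClone hC.perms hP1
        (vec4_ker (iff_of_false (by norm_num) h1) (iff_of_false (by norm_num) h2)
          (iff_of_false (by norm_num) h3) (iff_of_false (by norm_num) h4)
          (iff_of_false (by norm_num) h5) (iff_of_false (by norm_num) h6))
  obtain ⟨g, hg, hgt⟩ := hC.op_mem_tuples hf hr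
  have e0 : g ![0, 0] = f p := hgt 0
  have e1 : g ![0, 1] = f q := hgt 1
  have e2 : g ![1, 2] = f r := hgt 2
  have e3 : g ![1, 3] = f s := hgt 3
  exact ⟨g, hg, by rw [e0, e1, hpq], by rw [e2, e3]; exact hrs⟩

/-! ### Kernels realisable above the Horn clone. -/

section kernels

variable {C : Set Op} {n : ℕ} {ι : Type*} {P : ι → Fin n → ℕ}

theorem pair_mem_tuples (hC : IsNeqClone C) (hH : hornClone ⊆ C) {t s : ι → ℕ}
    (ht : t ∈ tuples C P) (hs : s ∈ tuples C P) :
    (fun i => Nat.pair (t i) (s i)) ∈ tuples C P :=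
  binary_mem_tuples hC.toIsClone (hH (mem_hornClone_of_injective (by norm_num) pair_injective))
    ht hs

/-- Above the Horn clone, kernels of tuples are closed under intersections. -/
theorem exists_ker_eq [Finite ι] (hC : IsNeqClone C) (hH : hornClone ⊆ C) {K : ι → ι → Prop}
    (h0 : ∃ t ∈ tuples C P, ∀ a b, K a b → t a = t b)
    (h : ∀ a b, ¬ K a b → ∃ t ∈ tuples C P, (∀ c d, K c d → t c = t d) ∧ t a ≠ t b) :
    ∃ t ∈ tuples C P, ∀ a b, t a = t b ↔ K a b := by
  obtain ⟨t, ⟨ht, htK⟩, hmin⟩ := (measure fun t : ι → ℕ =>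
    {p : ι × ι | t p.1 = t p.2}.ncard).wf.has_min
      {t | t ∈ tuples C P ∧ ∀ a b, K a b → t a = t b} h0
  refine ⟨t, ht, fun a b => ⟨fun hab => ?_, htK a b⟩⟩
  by_contra hK
  obtain ⟨s, hs, hsK, hsab⟩ := h a b hK
  refine hmin _ ⟨pair_mem_tuples hC hH ht hs, fun c d hcd => by
    simp only [htK c d hcd, hsK c d hcd]⟩ ?_
  refine Set.ncard_lt_ncard ⟨fun p hp => (Nat.pair_eq_pair.1 hp).1, fun hsub => hsab ?_⟩
    (Set.toFinite _)
  exact (Nat.pair_eq_pair.1 (hsub (show (a, b) ∈ _ from hab))).2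

theorem exists_collapsing [Finite ι] (hC : IsNeqClone C) (hH : hornClone ⊆ C)
    {g : (Fin 2 → ℕ) → ℕ} (hg : g ∈ fragment C 2) (hg1 : g ![0, 0] = g ![0, 1])
    (hg2 : g ![1, 2] ≠ g ![1, 3]) {U : ι → ℕ} (hU : U ∈ tuples C P) (S : Set ℕ) {u v : ι}
    (huv : U u = U v) (hS : U u ∉ S) {t : ι → ℕ} (ht : t ∈ tuples C P) (htuv : t u ≠ t v) :
    ∃ s ∈ tuples C P, s u ≠ s v ∧ (∀ a b, U a = U b → t a = t b → s a = s b) ∧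
      ∀ a b, U a = U b → U a ∈ S → s a = s b := by
  induction hk : {p : ι × ι | U p.1 = U p.2 ∧ U p.1 ∈ S ∧ t p.1 ≠ t p.2}.ncard
    using Nat.strong_induction_on generalizing t with
  | _ k ih =>
    by_cases hex : ∃ a b, U a = U b ∧ U a ∈ S ∧ t a ≠ t b
    swap
    · push Not at hex
      exact ⟨t, ht, htuv, fun _ _ _ h => h, hex⟩
    obtain ⟨a, b, hab, haS, htab⟩ := hex
    have hne : U a ≠ U u := fun e => hS (e ▸ haS)
    obtain ⟨α, hα, hαs⟩ := exists_perm_of_ker_eq ![U a, U u] ![0, 1]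
      (vec2_ker (iff_of_false hne zero_ne_one))
    -- Pairing with `U` makes the four values distinct even where `t` repeats values across the two
    -- classes. Applying `g` then merges `a, b` and keeps `u, v` apart.
    obtain ⟨γ, hγ, hγs⟩ := exists_perm_of_ker_eq
      ![Nat.pair (U a) (t a), Nat.pair (U a) (t b), Nat.pair (U u) (t u), Nat.pair (U u) (t v)]
      ![0, 1, 2, 3] (by
        apply vec4_ker <;> refine iff_of_false ?_ (by norm_num) <;>
          simp [Nat.pair_eq_pair, hne, htab, htuv])
    have hα0 : α (U a) = 0 := hαs 0
    have hα1 : α (U u) = 1 := hαs 1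
    have hγ0 : γ (Nat.pair (U a) (t a)) = 0 := hγs 0
    have hγ1 : γ (Nat.pair (U a) (t b)) = 1 := hγs 1
    have hγ2 : γ (Nat.pair (U u) (t u)) = 2 := hγs 2
    have hγ3 : γ (Nat.pair (U u) (t v)) = 3 := hγs 3
    let t' : ι → ℕ := fun i => g ![α (U i), γ (Nat.pair (U i) (t i))]
    have ht' : t' ∈ tuples C P := binary_mem_tuples hC.toIsClone hg (perm_mem_tuples hC hU hα)
      (perm_mem_tuples hC (pair_mem_tuples hC hH hU ht) hγ)
    have hmono : ∀ c d, U c = U d → t c = t d → t' c = t' d := fun c d h1 h2 => by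
      simp only [t', h1, h2]
    have ht'uv : t' u ≠ t' v := by
      simp only [t', ← huv, hα1, hγ2, hγ3]
      exact hg2
    have ht'ab : t' a = t' b := by
      simp only [t', ← hab, hα0, hγ0, hγ1]
      exact hg1
    obtain ⟨s, hs, h1, h2, h3⟩ := ih _ (by
      rw [← hk]
      refine Set.ncard_lt_ncard ⟨fun p hp => ⟨hp.1, hp.2.1, fun e => hp.2.2 (hmono _ _ hp.1 e)⟩,
        fun hsub => ?_⟩ (Set.toFinite _)
      exact (hsub (show (a, b) ∈ _ from ⟨hab, haS, htab⟩)).2.2 ht'ab) ht' ht'uv rfl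
    exact ⟨s, hs, h1, fun c d h h' => h2 c d h (hmono c d h h'), h3⟩

end kernels

/-- A clone that is not contained in the Horn clone contains all binary operations whose kernel
collapses the second variable on a given set of values of the first one. -/
theorem mem_of_collapse_ker {C : Set Op} (hC : IsNeqClone C) (hn : ¬ C ⊆ hornClone) (S : Set ℕ)
    {f : (Fin 2 → ℕ) → ℕ} (hf : ∀ a b, f a = f b ↔ a 0 = b 0 ∧ (a 0 ∈ S ∨ a 1 = b 1)) :
    f ∈ fragment C 2 := by
  have hH : hornClone ⊆ C := hornClone_subset_of_not_subset hC fun h =>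
    hn (h.trans (cl_injections_subset isNeqClone_hornClone))
  obtain ⟨⟨m, q⟩, hq, hqn⟩ := Set.not_subset.1 hn
  obtain ⟨g, hg, hg1, hg2⟩ := exists_binary_of_notMem_hornClone hC hq hqn
  refine mem_of_ker hC.toIsLocalClone hC.perms fun A => ?_
  simp only [hf]
  have hU := hC.proj_mem_tuples (fun a : A => a.1) 0
  refine exists_ker_eq hC hH ⟨_, hU, fun a b h => h.1⟩ fun u v huv => ?_
  by_cases h0 : u.1 0 = v.1 0
  swap
  · exact ⟨_, hU, fun _ _ h => h.1, h0⟩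
  simp only [h0, true_and, not_or] at huv
  obtain ⟨s, hs, h1, h2, h3⟩ := exists_collapsing hC hH hg hg1 hg2 hU S (u := u) (v := v) h0
    (by rw [h0]; exact huv.1) (hC.proj_mem_tuples _ 1) huv.2
  exact ⟨s, hs, fun c d hcd => hcd.2.elim (h3 c d hcd.1) (h2 c d hcd.1), h1⟩

/-- The collapse of a tuple on a union of classes of another one. -/
theorem collapse_mem_tuples {C : Set Op} (hC : IsNeqClone C) (hn : ¬ C ⊆ hornClone) (S : Set ℕ)
    {n : ℕ} {ι : Type*} {P : ι → Fin n → ℕ} {U t : ι → ℕ} (hU : U ∈ tuples C P)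
    (ht : t ∈ tuples C P) :
    ∃ s ∈ tuples C P, ∀ a b, s a = s b ↔ U a = U b ∧ (U a ∈ S ∨ t a = t b) := by
  classical
  let f : (Fin 2 → ℕ) → ℕ := fun x => Nat.pair (x 0) (if x 0 ∈ S then 0 else x 1)
  have hf : ∀ a b, f a = f b ↔ a 0 = b 0 ∧ (a 0 ∈ S ∨ a 1 = b 1) := fun a b => by
    simp only [f, Nat.pair_eq_pair]
    refine and_congr_right fun h => ?_
    rw [h]
    split_ifs with hS <;> simp [hS]
  exact ⟨_, binary_mem_tuples hC.toIsClone (mem_of_collapse_ker hC hn S hf) hU ht,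
    fun a b => hf _ _⟩

/-! ### Bar functions and the clone they generate. -/

theorem IsBarFunction.eq_iff {k : ℕ} {f : (Fin 2 → ℕ) → ℕ} (hf : IsBarFunction k f)
    (a b : Fin 2 → ℕ) : f a = f b ↔ a 0 = b 0 ∧ (a 0 ∈ {x | x < k} ∨ a 1 = b 1) := by
  obtain ⟨p, hp, h1, h2⟩ := hf
  have hv : ∀ a : Fin 2 → ℕ, a = ![a 0, a 1] := fun a => by
    funext i; fin_cases i <;> rfl
  have hfp : ∀ a : Fin 2 → ℕ, f a = p ![a 0, if a 0 < k then 0 else a 1] := fun a => by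
    conv_lhs => rw [hv a]
    split_ifs with h
    · exact (h2 _ _ h).1
    · exact h1 _ _ (not_lt.1 h)
  have hpv : ∀ x y x' y', p ![x, y] = p ![x', y'] ↔ x = x' ∧ y = y' := fun x y x' y' => by
    rw [hp.eq_iff]
    refine ⟨fun h => ⟨congrFun h 0, congrFun h 1⟩, fun h => by rw [h.1, h.2]⟩
  rw [hfp, hfp, hpv]
  refine and_congr_right fun h => ?_
  rw [h]
  split_ifs with hk <;> simp [hk]

theorem IsBarFunction.mem_Pol_neq {k : ℕ} {f : (Fin 2 → ℕ) → ℕ} (hf : IsBarFunction k f) :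
    (⟨2, f⟩ : Op) ∈ Pol {neqRel} :=
  EqClone.mem_Pol_neq.2 ⟨by norm_num, fun a b hab h => hab (0 : Fin 2) ((hf.eq_iff a b).1 h).1⟩

theorem IsBarFunction.notMem_hornClone {k : ℕ} (hk : 1 ≤ k) {f : (Fin 2 → ℕ) → ℕ}
    (hf : IsBarFunction k f) : (⟨2, f⟩ : Op) ∉ hornClone := by
  intro h
  obtain ⟨V, hV, hVk⟩ := mem_hornClone_iff.1 h
  have h1 := (hVk ![0, 0] ![0, 1]).1 ((hf.eq_iff _ _).2 ⟨rfl, Or.inl hk⟩)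
  have h2 : f ![k, 0] = f ![k, 1] := (hVk ![k, 0] ![k, 1]).2 fun (i : Fin 2) hi => by
    fin_cases i
    · rfl
    · exact absurd (h1 _ hi) zero_ne_one
  rcases ((hf.eq_iff _ _).1 h2).2 with h | h
  · exact lt_irrefl k h
  · exact zero_ne_one h

theorem isNeqClone_barClone : IsNeqClone barClone := by
  have h : {f | ∃ k, 1 ≤ k ∧ ∃ b, IsBarFunction k b ∧ f = ⟨2, b⟩} ∪ unaryOp '' perms ⊆
      Pol {neqRel} := by
    refine Set.union_subset ?_ perms_subset_Pol_neq
    rintro _ ⟨k, -, b, hb, rfl⟩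
    exact hb.mem_Pol_neq
  exact { isLocalClone_cl fun g hg => (h hg).1 with
    perms := Set.subset_union_right.trans (subset_cl _)
    neq := cl_subset (isLocalClone_Pol _) h }

theorem barClone_subset {C : Set Op} (hC : IsNeqClone C) (hn : ¬ C ⊆ hornClone) :
    barClone ⊆ C := by
  refine cl_subset hC.toIsLocalClone (Set.union_subset ?_ hC.perms)
  rintro _ ⟨k, -, b, hb, rfl⟩
  exact mem_of_collapse_ker hC hn {x | x < k} hb.eq_iff

theorem IsBarFunction.gen_eq {k : ℕ} (hk : 1 ≤ k) {b : (Fin 2 → ℕ) → ℕ}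
    (hb : IsBarFunction k b) : gen ⟨2, b⟩ = barClone :=
  (gen_subset isNeqClone_barClone.toIsLocalClone isNeqClone_barClone.perms
    (subset_cl _ (Or.inl ⟨k, hk, b, hb, rfl⟩))).antisymm
    (barClone_subset (isNeqClone_gen hb.mem_Pol_neq) fun h =>
      hb.notMem_hornClone hk (h (mem_gen_self _)))

theorem exists_isBarFunction : ∃ b, IsBarFunction 1 b := by
  refine ⟨fun x => if x 0 = 0 then 0 else Nat.pair (x 0) (x 1), _, pair_injective, ?_, ?_⟩
  · intro x y hx
    exact if_neg (by change x ≠ 0; omega)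
  · intro x y hx
    obtain rfl : x = 0 := by omega
    exact ⟨rfl, rfl⟩

theorem barClone_not_subset : ¬ barClone ⊆ hornClone := fun h => by
  obtain ⟨b, hb⟩ := exists_isBarFunction
  exact hb.notMem_hornClone le_rfl (h (subset_cl _ (Or.inl ⟨1, le_rfl, b, hb, rfl⟩)))

theorem hornClone_subset_barClone : hornClone ⊆ barClone :=
  hornClone_subset_of_not_subset isNeqClone_barClone fun h =>
    barClone_not_subset (h.trans (cl_injections_subset isNeqClone_hornClone))

theorem isUniqueCoverIn_barClone :
    IsUniqueCoverIn (monoidalInterval injections) hornClone barClone :=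
  isUniqueCoverIn_of_forall (mem_monoidalInterval.2 isNeqClone_hornClone)
    (mem_monoidalInterval.2 isNeqClone_barClone)
    (lt_of_le_not_ge hornClone_subset_barClone barClone_not_subset)
    fun _ hC hle hne => barClone_subset (mem_monoidalInterval.1 hC) fun h => hne (h.antisymm hle)

theorem barClone_subset_of_ne {C : Set Op} (hC : IsNeqClone C)
    (h1 : C ≠ cl (unaryOp '' injections)) (h2 : C ≠ hornClone) : barClone ⊆ C :=
  barClone_subset hC fun h => h2 (h.antisymm (hornClone_subset_of_ne hC h1))

/-! ### Operations preserving the relation "all equal or all distinct" -/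

/-- The ternary relation "all equal or all distinct". -/
def oddRel : Rel := ⟨3, {a | Injective a ∨ ∀ j k, a j = a k}⟩

theorem hornClone_subset_Pol_oddRel : hornClone ⊆ Pol {oddRel} := by
  intro f hf
  refine ⟨isLocalClone_hornClone.pos f hf, ?_⟩
  rintro _ rfl r hr
  obtain ⟨V, -, hVk⟩ := mem_hornClone_iff.1 hf
  by_cases h : ∃ i ∈ V, Injective (r i)
  · obtain ⟨i, hi, hinj⟩ := h
    exact Or.inl fun j k hjk => hinj ((hVk _ _).1 hjk i hi)
  · push Not at h
    exact Or.inr fun j k => (hVk _ _).2 fun i hi => (hr i).resolve_left (h i hi) j k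

theorem vec3_mem_oddRel {a b c : ℕ} (h : (a = b ∧ b = c) ∨ (a ≠ b ∧ b ≠ c ∧ a ≠ c)) :
    (![a, b, c] : Fin oddRel.1 → ℕ) ∈ oddRel.2 := by
  rcases h with ⟨rfl, rfl⟩ | ⟨h1, h2, h3⟩
  · exact Or.inr fun (j : Fin 3) (k : Fin 3) => by fin_cases j <;> fin_cases k <;> rfl
  · refine Or.inl fun (j : Fin 3) (k : Fin 3) hjk => ?_
    have := (vec3_ker (a' := 0) (b' := 1) (c' := 2) (iff_of_false h1 (by norm_num))
      (iff_of_false h3 (by norm_num)) (iff_of_false h2 (by norm_num)) j k).1 hjk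
    fin_cases j <;> fin_cases k <;> first | rfl | exact absurd this (by decide)

section cubes

variable {n : ℕ} {f : (Fin n → ℕ) → ℕ}

theorem eq_of_mem_Pol_oddRel (hf : (⟨n, f⟩ : Op) ∈ Pol {oddRel}) {a b c : Fin n → ℕ}
    (h : ∀ i, (a i = b i ∧ b i = c i) ∨ (a i ≠ b i ∧ b i ≠ c i ∧ a i ≠ c i)) (hab : f a = f b) :
    f b = f c := by
  rcases hf.2 oddRel rfl (fun i => ![a i, b i, c i]) fun i => vec3_mem_oddRel (h i) with h | h
  · exact absurd (@h (0 : Fin 3) (1 : Fin 3) hab) zero_ne_one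
  · exact h (1 : Fin 3) (2 : Fin 3)

/-- Two points of the same kernel class span a subcube of that class. -/
theorem eq_of_mem_cube (hf : (⟨n, f⟩ : Op) ∈ Pol {oddRel}) {a b z : Fin n → ℕ} (hab : f a = f b)
    (hz : ∀ i, a i = b i → z i = a i) : f z = f a := by
  -- For `k ≥ 1` this exceeds `a`, `b` and `z` off the fixed coordinates. Two such points share the
  -- class of `a`, and together with `z` they form a triple to which the relation applies.
  let c : ℕ → Fin n → ℕ := fun k i => if a i = b i then a i else a i + b i + z i + k
  have hc : ∀ k, 1 ≤ k → f b = f (c k) := fun k hk => eq_of_mem_Pol_oddRel hf (fun i => by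
    by_cases h : a i = b i
    · simp [c, h]
    · right
      simp only [c, h, if_false]
      omega) hab
  have h2 : f (c 2) = f z := eq_of_mem_Pol_oddRel hf (a := c 1) (fun i => by
    by_cases h : a i = b i
    · simp [c, h, hz i h]
    · right
      simp only [c, h, if_false]
      omega) ((hc 1 le_rfl).symm.trans (hc 2 (by norm_num)))
  rw [← h2, ← hc 2 (by norm_num), hab]

/-- Each kernel class is a subcube. -/
theorem eq_of_forall_fixed (hf : (⟨n, f⟩ : Op) ∈ Pol {oddRel}) {a z : Fin n → ℕ}
    (hz : ∀ i, (∀ y, f y = f a → y i = a i) → z i = a i) : f z = f a := by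
  classical
  have key : ∀ D : Finset (Fin n), (∀ i ∈ D, ∃ y, f y = f a ∧ y i ≠ a i) →
      ∃ y, f y = f a ∧ ∀ i ∈ D, y i ≠ a i := by
    intro D
    induction D using Finset.induction_on with
    | empty => exact fun _ => ⟨a, rfl, by simp⟩
    | insert i D hi ih =>
      intro h
      obtain ⟨b, hb, hbD⟩ := ih fun j hj => h j (Finset.mem_insert_of_mem hj)
      obtain ⟨d, hd, hdi⟩ := h i (Finset.mem_insert_self i D)
      -- The points `b'` and `d'` agree only where `a`, `b` and `d` all agree, so the cube they span
      -- frees every coordinate freed by `b` or by `d`; `e` uses them all.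
      let b' : Fin n → ℕ := fun j => if a j = b j then a j else a j + 1
      let d' : Fin n → ℕ := fun j => if a j = d j then a j else a j + 2
      have hb' : f b' = f a := eq_of_mem_cube hf hb.symm fun j hj => by simp [b', hj]
      have hd' : f d' = f a := eq_of_mem_cube hf hd.symm fun j hj => by simp [d', hj]
      let e : Fin n → ℕ := fun j => if a j = b j ∧ a j = d j then a j else a j + 3
      refine ⟨e, ?_, fun j hj => ?_⟩
      · rw [← hb']
        refine eq_of_mem_cube hf (hb'.trans hd'.symm) fun j hj => ?_
        simp only [b', d', e] at hj ⊢
        split_ifs at hj ⊢ <;> first | rfl | omega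
      · rcases Finset.mem_insert.1 hj with rfl | hj
        · simp [e, hdi.symm]
        · simp [e, (hbD j hj).symm]
  obtain ⟨b, hb, hbD⟩ := key (Finset.univ.filter fun i => ∃ y, f y = f a ∧ y i ≠ a i) (by simp)
  refine eq_of_mem_cube hf hb.symm fun i hi => hz i fun y hy => ?_
  by_contra hne
  exact hbD i (Finset.mem_filter.2 ⟨Finset.mem_univ i, y, hy, hne⟩) hi.symm

theorem exists_separating_fixed (hf : (⟨n, f⟩ : Op) ∈ Pol {oddRel}) {a b : Fin n → ℕ}
    (hab : f a ≠ f b) :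
    ∃ i, (∀ y, f y = f a → y i = a i) ∧ (∀ y, f y = f b → y i = b i) ∧ a i ≠ b i := by
  classical
  by_contra! hcon
  -- Without a separating coordinate fixed on both classes, the two cubes would meet in this point.
  let z : Fin n → ℕ := fun i => if ∀ y, f y = f a → y i = a i then a i else b i
  have h1 : f z = f a := eq_of_forall_fixed hf fun i hi => by simp only [z]; rw [if_pos hi]
  have h2 : f z = f b := eq_of_forall_fixed hf fun i hi => by
    simp only [z]
    split_ifs with h
    · exact hcon i h hi
    · rfl
  exact hab (h1.symm.trans h2)

end cubes

/-! ### The odd clone -/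

theorem vec3_eta (y : Fin 3 → ℕ) : y = ![y 0, y 1, y 2] := by
  funext i; fin_cases i <;> rfl

theorem IsOddGenerator.eq_cases {g : (Fin 3 → ℕ) → ℕ} (hg : IsOddGenerator g) {y z : Fin 3 → ℕ}
    (h : g y = g z) : y = z ∨ ((y 1 = 1 ∧ y 2 = 1) ∧ z 1 = 1 ∧ z 2 = 1) ∨
      ((y 0 = 2 ∧ y 2 = 2) ∧ z 0 = 2 ∧ z 2 = 2) ∨ ((y 0 = 3 ∧ y 1 = 3) ∧ z 0 = 3 ∧ z 1 = 3) := by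
  obtain ⟨h1, h2, h3, h4⟩ := hg
  have hline : ∀ y : Fin 3 → ℕ, (∃ x, y = ![x, 1, 1] ∨ y = ![2, x, 2] ∨ y = ![3, 3, x]) →
      (g y = 1 ∧ y 1 = 1 ∧ y 2 = 1) ∨ (g y = 2 ∧ y 0 = 2 ∧ y 2 = 2) ∨
        (g y = 3 ∧ y 0 = 3 ∧ y 1 = 3) := by
    rintro y ⟨x, rfl | rfl | rfl⟩
    · exact Or.inl ⟨h1 x, rfl, rfl⟩
    · exact Or.inr (Or.inl ⟨h2 x, rfl, rfl⟩)
    · exact Or.inr (Or.inr ⟨h3 x, rfl, rfl⟩)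
  by_cases hy : ∃ x, y = ![x, 1, 1] ∨ y = ![2, x, 2] ∨ y = ![3, 3, x]
  · by_cases hz : ∃ x, z = ![x, 1, 1] ∨ z = ![2, x, 2] ∨ z = ![3, 3, x]
    · have := hline y hy
      have := hline z hz
      omega
    · by_contra! hne
      exact h4 z hz y hne.1 h
  · by_contra! hne
    exact h4 y hy z hne.1.symm h.symm

theorem IsOddGenerator.mem_Pol_neq {g : (Fin 3 → ℕ) → ℕ} (hg : IsOddGenerator g) :
    (⟨3, g⟩ : Op) ∈ Pol {neqRel} := by
  refine EqClone.mem_Pol_neq.2 ⟨by norm_num, fun (a : Fin 3 → ℕ) (b : Fin 3 → ℕ) hab h => ?_⟩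
  have h0 : a 0 ≠ b 0 := hab (0 : Fin 3)
  have h1 : a 1 ≠ b 1 := hab (1 : Fin 3)
  rcases hg.eq_cases h with rfl | h | h | h
  · exact h0 rfl
  all_goals omega

theorem IsOddGenerator.mem_Pol_oddRel {g : (Fin 3 → ℕ) → ℕ} (hg : IsOddGenerator g) :
    (⟨3, g⟩ : Op) ∈ Pol {oddRel} := by
  refine ⟨by norm_num, ?_⟩
  rintro _ rfl r hr
  by_contra hcon
  obtain ⟨h1, h2⟩ := not_or.1 hcon
  refine h2 ?_
  simp only [Injective, not_forall] at h1
  obtain ⟨j, k, hjk, hne⟩ := h1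
  have hrow : ∀ i, r i j = r i k → ∀ l, r i l = r i j := fun i h l =>
    (hr i).elim (fun hinj => absurd (hinj h) hne) fun hc => hc l j
  intro l l'
  change g (fun i => r i l) = g (fun i => r i l')
  rcases hg.eq_cases hjk with h | h | h | h
  · congr 1
    funext i
    rw [hrow i (congrFun h i) l, hrow i (congrFun h i) l']
  · have e : ∀ l, g (fun i => r i l) = 1 := fun l => by
      have h1 : r (1 : Fin 3) l = 1 := (hrow _ (h.1.1.trans h.2.1.symm) l).trans h.1.1
      have h2 : r (2 : Fin 3) l = 1 := (hrow _ (h.1.2.trans h.2.2.symm) l).trans h.1.2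
      rw [vec3_eta fun i => r i l, h1, h2]
      exact hg.1 _
    exact (e l).trans (e l').symm
  · have e : ∀ l, g (fun i => r i l) = 2 := fun l => by
      have h1 : r (0 : Fin 3) l = 2 := (hrow _ (h.1.1.trans h.2.1.symm) l).trans h.1.1
      have h2 : r (2 : Fin 3) l = 2 := (hrow _ (h.1.2.trans h.2.2.symm) l).trans h.1.2
      rw [vec3_eta fun i => r i l, h1, h2]
      exact hg.2.1 _
    exact (e l).trans (e l').symm
  · have e : ∀ l, g (fun i => r i l) = 3 := fun l => by
      have h1 : r (0 : Fin 3) l = 3 := (hrow _ (h.1.1.trans h.2.1.symm) l).trans h.1.1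
      have h2 : r (1 : Fin 3) l = 3 := (hrow _ (h.1.2.trans h.2.2.symm) l).trans h.1.2
      rw [vec3_eta fun i => r i l, h1, h2]
      exact hg.2.2.1 _
    exact (e l).trans (e l').symm

theorem perm_comp_mem {C : Set Op} (hC : IsNeqClone C) {n : ℕ} {h : (Fin n → ℕ) → ℕ}
    (hh : h ∈ fragment C n) {e : ℕ → ℕ} (he : Bijective e) : (fun x => e (h x)) ∈ fragment C n :=
  hC.comp 1 n (fun x => e (x 0)) (fun _ => h) (hC.perms ⟨e, he, rfl⟩) fun _ => hh

/-- An odd generator collapses any finite set of kernel classes of an operation that preserves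
`oddRel`, keeping them apart. -/
theorem exists_collapsing_classes {C : Set Op} (hC : IsNeqClone C) {g : (Fin 3 → ℕ) → ℕ}
    (hg : IsOddGenerator g) (hgC : g ∈ fragment C 3) {n : ℕ} {f : (Fin n → ℕ) → ℕ}
    (hf : (⟨n, f⟩ : Op) ∈ Pol {oddRel}) (hfn : (⟨n, f⟩ : Op) ∈ Pol {neqRel})
    (B : Finset (Fin n → ℕ)) (hB : Set.InjOn f B) :
    ∃ h ∈ fragment C n, (∀ a ∈ B, ∀ z, f z = f a → h z = h a) ∧ Set.InjOn h B := by
  classical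
  have hproj : ∀ a b, f a ≠ f b → ∃ h ∈ fragment C n, (∀ z, f z = f a → h z = h a) ∧
      (∀ z, f z = f b → h z = h b) ∧ h a ≠ h b := fun a b hab => by
    obtain ⟨i, h1, h2, h3⟩ := exists_separating_fixed hf hab
    exact ⟨_, hC.proj n i, h1, h2, h3⟩
  induction hk : B.card using Nat.strong_induction_on generalizing B with
  | _ k ih =>
    by_cases hk3 : 3 ≤ k
    -- Let `t₁`, `t₂`, `t₃` each ignore one of three classes. On the class ignored by one of them
    -- the other two are constant, and after the normalising permutations `e₁`, `e₂`, `e₃` they hit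
    -- one of the three lines on which `g` forgets a variable.
    · obtain ⟨a₁, a₂, a₃, h₁, h₂, h₃, h12, h13, h23⟩ :=
        Finset.two_lt_card_iff.1 (show 2 < B.card by omega)
      have herase : ∀ a ∈ B, ∃ h ∈ fragment C n,
          (∀ b ∈ B, b ≠ a → ∀ z, f z = f b → h z = h b) ∧
          ∀ b ∈ B, ∀ c ∈ B, b ≠ a → c ≠ a → h b = h c → b = c := fun a ha => by
        obtain ⟨h, hh, hc, hi⟩ := ih _ (hk ▸ Finset.card_erase_lt_of_mem ha) (B.erase a)
          (hB.mono (by simp)) rfl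
        exact ⟨h, hh, fun b hb hba => hc b (Finset.mem_erase.2 ⟨hba, hb⟩),
          fun b hb c hc hba hca => hi (Finset.mem_erase.2 ⟨hba, hb⟩)
            (Finset.mem_erase.2 ⟨hca, hc⟩)⟩
      obtain ⟨t₁, ht₁, hc₁, hi₁⟩ := herase a₁ h₁
      obtain ⟨t₂, ht₂, hc₂, hi₂⟩ := herase a₂ h₂
      obtain ⟨t₃, ht₃, hc₃, hi₃⟩ := herase a₃ h₃
      have hperm : ∀ {x y u v : ℕ}, x ≠ y → u ≠ v →
          ∃ e : ℕ → ℕ, Bijective e ∧ e x = u ∧ e y = v := fun {x y u v} hxy huv => by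
        obtain ⟨e, he, hes⟩ := exists_perm_of_ker_eq ![x, y] ![u, v]
          (vec2_ker (iff_of_false hxy huv))
        exact ⟨e, he, hes 0, hes 1⟩
      obtain ⟨e₁, he₁, e12, e13⟩ := hperm (u := 2) (v := 3)
        (fun e => h23 (hi₁ _ h₂ _ h₃ h12.symm h13.symm e)) (by norm_num)
      obtain ⟨e₂, he₂, e21, e23⟩ := hperm (u := 1) (v := 3)
        (fun e => h13 (hi₂ _ h₁ _ h₃ h12 h23.symm e)) (by norm_num)
      obtain ⟨e₃, he₃, e31, e32⟩ := hperm (u := 1) (v := 2)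
        (fun e => h12 (hi₃ _ h₁ _ h₂ h13 h23 e)) (by norm_num)
      have hmem : (fun x => g ![e₁ (t₁ x), e₂ (t₂ x), e₃ (t₃ x)]) ∈ fragment C n := by
        have := hC.comp 3 n g
          ![fun x => e₁ (t₁ x), fun x => e₂ (t₂ x), fun x => e₃ (t₃ x)] hgC fun i => by
            fin_cases i
            · exact perm_comp_mem hC ht₁ he₁
            · exact perm_comp_mem hC ht₂ he₂
            · exact perm_comp_mem hC ht₃ he₃
        convert this using 3 with x
        funext i
        fin_cases i <;> rfl
      refine ⟨_, hmem, fun a ha z hz => ?_, fun a ha b hb hab => ?_⟩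
      · by_cases ha1 : a = a₁
        · subst ha1
          simp only [hc₂ a h₁ h12 z hz, hc₃ a h₁ h13 z hz, e21, e31, hg.1]
        by_cases ha2 : a = a₂
        · subst ha2
          simp only [hc₁ a h₂ h12.symm z hz, hc₃ a h₂ h23 z hz, e12, e32, hg.2.1]
        by_cases ha3 : a = a₃
        · subst ha3
          simp only [hc₁ a h₃ h13.symm z hz, hc₂ a h₃ h23.symm z hz, e13, e23, hg.2.2.1]
        simp only [hc₁ a ha ha1 z hz, hc₂ a ha ha2 z hz, hc₃ a ha ha3 z hz]
      · have hL1 : ∀ a ∈ B, e₂ (t₂ a) = 1 ∧ e₃ (t₃ a) = 1 → a = a₁ := fun a ha h => by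
          have hne : a ≠ a₂ := by rintro rfl; rw [e32] at h; omega
          exact hi₂ a ha a₁ h₁ hne h12 (he₂.1 (h.1.trans e21.symm))
        have hL2 : ∀ a ∈ B, e₁ (t₁ a) = 2 ∧ e₃ (t₃ a) = 2 → a = a₂ := fun a ha h => by
          have hne : a ≠ a₁ := by rintro rfl; rw [e31] at h; omega
          exact hi₁ a ha a₂ h₂ hne h12.symm (he₁.1 (h.1.trans e12.symm))
        have hL3 : ∀ a ∈ B, e₁ (t₁ a) = 3 ∧ e₂ (t₂ a) = 3 → a = a₃ := fun a ha h => by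
          have hne : a ≠ a₁ := by rintro rfl; rw [e21] at h; omega
          exact hi₁ a ha a₃ h₃ hne h13.symm (he₁.1 (h.1.trans e13.symm))
        rcases hg.eq_cases hab with h | h | h | h
        · have q1 : t₁ a = t₁ b := he₁.1 (congrFun h 0)
          have q2 : t₂ a = t₂ b := he₂.1 (congrFun h 1)
          have q3 : t₃ a = t₃ b := he₃.1 (congrFun h 2)
          by_contra hne
          have r1 : a = a₁ ∨ b = a₁ := by
            by_contra! hh
            exact hne (hi₁ a ha b hb hh.1 hh.2 q1)
          have r2 : a = a₂ ∨ b = a₂ := by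
            by_contra! hh
            exact hne (hi₂ a ha b hb hh.1 hh.2 q2)
          have r3 : a = a₃ ∨ b = a₃ := by
            by_contra! hh
            exact hne (hi₃ a ha b hb hh.1 hh.2 q3)
          -- The three distinct points `a₁`, `a₂`, `a₃` would all lie in `{a, b}`.
          grind
        · exact (hL1 a ha h.1).trans (hL1 b hb h.2).symm
        · exact (hL2 a ha h.1).trans (hL2 b hb h.2).symm
        · exact (hL3 a ha h.1).trans (hL3 b hb h.2).symm
    -- At most two classes: `B` is padded to two, and a single projection suffices.
    · have hsmall : ∃ a b, f a ≠ f b ∧ B ⊆ {a, b} := by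
        have hne : ∀ a : Fin n → ℕ, f a ≠ f fun i => a i + 1 := fun a =>
          (mem_Pol_neq.1 hfn).2 _ _ fun i => by simp
        interval_cases k
        · rw [Finset.card_eq_zero] at hk
          exact ⟨0, _, hne 0, by simp [hk]⟩
        · obtain ⟨a, rfl⟩ := Finset.card_eq_one.1 hk
          exact ⟨a, _, hne a, by simp⟩
        · obtain ⟨a, b, hab, rfl⟩ := Finset.card_eq_two.1 hk
          exact ⟨a, b, fun e => hab (hB (by simp) (by simp) e), subset_rfl⟩
      obtain ⟨a, b, hab, hBs⟩ := hsmall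
      obtain ⟨h, hh, h1, h2, h3⟩ := hproj a b hab
      refine ⟨h, hh, fun c hc z hz => ?_, fun c hc d hd hcd => ?_⟩
      · have := hBs hc
        simp only [Finset.mem_insert, Finset.mem_singleton] at this
        rcases this with rfl | rfl
        · exact h1 z hz
        · exact h2 z hz
      · have hc' := hBs hc
        have hd' := hBs hd
        simp only [Finset.mem_insert, Finset.mem_singleton] at hc' hd'
        rcases hc' with rfl | rfl <;> rcases hd' with rfl | rfl
        · rfl
        · exact absurd hcd h3
        · exact absurd hcd.symm h3
        · rfl

theorem mem_of_isOddGenerator {C : Set Op} (hC : IsNeqClone C) {g : (Fin 3 → ℕ) → ℕ}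
    (hg : IsOddGenerator g) (hgC : g ∈ fragment C 3) : Pol {oddRel} ∩ Pol {neqRel} ⊆ C := by
  rintro ⟨n, f⟩ ⟨hf, hfn⟩
  refine mem_of_ker hC.toIsLocalClone hC.perms fun A => ?_
  obtain ⟨B, hBA, hB⟩ := Set.exists_subset_bijOn (A : Set (Fin n → ℕ)) f
  have hfin : B.Finite := A.finite_toSet.subset hBA
  obtain ⟨h, hh, h1, h2⟩ := exists_collapsing_classes hC hg hgC hf hfn hfin.toFinset
    (by simpa using hB.injOn)
  simp only [Set.Finite.mem_toFinset, Set.Finite.coe_toFinset] at h1 h2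
  refine ⟨fun a => h a, ⟨h, hh, fun _ => rfl⟩, fun a b => ?_⟩
  obtain ⟨a', ha', ea⟩ := hB.surjOn (Set.mem_image_of_mem f a.2)
  obtain ⟨b', hb', eb⟩ := hB.surjOn (Set.mem_image_of_mem f b.2)
  change h a = h b ↔ _
  rw [h1 a' ha' a ea.symm, h1 b' hb' b eb.symm, ← ea, ← eb]
  exact ⟨fun e => by rw [h2 ha' hb' e], fun e => by rw [hB.injOn ha' hb' e]⟩

theorem oddClone_le : oddClone ⊆ Pol {oddRel} ∩ Pol {neqRel} := by
  refine Set.subset_inter (cl_subset (isLocalClone_Pol _) (Set.union_subset ?_ ?_))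
    (cl_subset (isLocalClone_Pol _) (Set.union_subset ?_ perms_subset_Pol_neq))
  · rintro _ ⟨g, hg, rfl⟩
    exact hg.mem_Pol_oddRel
  · exact isNeqClone_hornClone.perms.trans hornClone_subset_Pol_oddRel
  · rintro _ ⟨g, hg, rfl⟩
    exact hg.mem_Pol_neq

theorem isNeqClone_oddClone : IsNeqClone oddClone :=
  { isLocalClone_cl (by
      rintro f (⟨g, hg, rfl⟩ | hf)
      · exact hg.mem_Pol_neq.1
      · exact (perms_subset_Pol_neq hf).1) with
    perms := Set.subset_union_right.trans (subset_cl _)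
    neq := fun _ hf => (oddClone_le hf).2 }

theorem IsOddGenerator.mem_oddClone {g : (Fin 3 → ℕ) → ℕ} (hg : IsOddGenerator g) :
    (⟨3, g⟩ : Op) ∈ oddClone := subset_cl _ (Or.inl ⟨g, hg, rfl⟩)

theorem IsOddGenerator.gen_eq {g : (Fin 3 → ℕ) → ℕ} (hg : IsOddGenerator g) :
    gen ⟨3, g⟩ = oddClone :=
  (gen_subset isNeqClone_oddClone.toIsLocalClone isNeqClone_oddClone.perms hg.mem_oddClone).antisymm
    (oddClone_le.trans (mem_of_isOddGenerator (isNeqClone_gen hg.mem_Pol_neq) hg (mem_gen_self _)))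

theorem exists_isOddGenerator : ∃ g, IsOddGenerator g := by
  classical
  obtain ⟨p, hp⟩ := exists_injective_nat (Fin 3 → ℕ)
  let g : (Fin 3 → ℕ) → ℕ := fun y => if y 1 = 1 ∧ y 2 = 1 then 1 else
    if y 0 = 2 ∧ y 2 = 2 then 2 else if y 0 = 3 ∧ y 1 = 3 then 3 else p y + 4
  refine ⟨g, fun x => rfl, fun x => by simp [g], fun x => by simp [g], fun a ha b hba => ?_⟩
  have h1 : ¬ (a 1 = 1 ∧ a 2 = 1) := fun h => ha ⟨a 0, Or.inl (by
    conv_lhs => rw [vec3_eta a, h.1, h.2])⟩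
  have h2 : ¬ (a 0 = 2 ∧ a 2 = 2) := fun h => ha ⟨a 1, Or.inr (Or.inl (by
    conv_lhs => rw [vec3_eta a, h.1, h.2]))⟩
  have h3 : ¬ (a 0 = 3 ∧ a 1 = 3) := fun h => ha ⟨a 2, Or.inr (Or.inr (by
    conv_lhs => rw [vec3_eta a, h.1, h.2]))⟩
  have hne := hp.ne hba
  simp only [g, h1, h2, h3, if_false]
  split_ifs <;> omega

theorem oddClone_eq : oddClone = Pol {oddRel} ∩ Pol {neqRel} := by
  obtain ⟨g, hg⟩ := exists_isOddGenerator
  exact oddClone_le.antisymm (mem_of_isOddGenerator isNeqClone_oddClone hg hg.mem_oddClone)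

theorem oddClone_not_subset : ¬ oddClone ⊆ richardClone := fun h => by
  obtain ⟨g, hg⟩ := exists_isOddGenerator
  obtain ⟨i, hi⟩ := h hg.mem_oddClone
  change Fin 3 at i
  fin_cases i
  · exact hi ![0, 1, 1] ![1, 1, 1] zero_ne_one ((hg.1 0).trans (hg.1 1).symm)
  · exact hi ![2, 0, 2] ![2, 1, 2] zero_ne_one ((hg.2.1 0).trans (hg.2.1 1).symm)
  · exact hi ![3, 3, 0] ![3, 3, 1] zero_ne_one ((hg.2.2.1 0).trans (hg.2.2.1 1).symm)

/-! ### Operations injective in one direction -/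

theorem isLocalClone_richardClone : IsLocalClone richardClone where
  pos f hf := by
    obtain ⟨i, -⟩ := hf
    have := i.2
    omega
  proj n k := ⟨k, fun _ _ h => h⟩
  comp n m f g hf hg := by
    obtain ⟨i, hi⟩ := hf
    obtain ⟨j, hj⟩ := hg i
    exact ⟨j, fun a b hab => hi _ _ (hj a b hab)⟩
  closed n := by
    have : fragment richardClone n = ⋃ i : Fin n,
        {f : (Fin n → ℕ) → ℕ | ∀ a b, a i ≠ b i → f a ≠ f b} := by
      ext f
      simp only [Set.mem_iUnion]
      exact Iff.rfl
    rw [this]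
    refine isClosed_iUnion_of_finite fun i => isClosed_iff_local.2 fun f hf a b hab => ?_
    obtain ⟨g, hg, hgf⟩ := hf {a, b}
    rw [← hgf a (by simp), ← hgf b (by simp)]
    exact hg a b hab

theorem isNeqClone_richardClone : IsNeqClone richardClone :=
  { isLocalClone_richardClone with
    perms := by
      rintro _ ⟨g, hg, rfl⟩
      exact ⟨(0 : Fin 1), fun a b hab h => hab (hg.1 h)⟩
    neq := fun f hf => by
      refine mem_Pol_neq.2 ⟨isLocalClone_richardClone.pos f hf, fun a b hab => ?_⟩
      obtain ⟨i, hi⟩ := hf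
      exact hi a b (hab i) }

theorem richardClone_not_subset : ¬ richardClone ⊆ Pol {oddRel} := by
  intro h
  let f : (Fin 2 → ℕ) → ℕ := fun x => Nat.pair (x 0) (if x 1 = 0 then 0 else 1)
  have hf : (⟨2, f⟩ : Op) ∈ richardClone :=
    ⟨(0 : Fin 2), fun a b hab h => hab (Nat.pair_eq_pair.1 h).1⟩
  rcases (h hf).2 oddRel rfl ![![0, 0, 0], ![1, 2, 0]] (fun (i : Fin 2) => by
    fin_cases i
    · exact vec3_mem_oddRel (Or.inl ⟨rfl, rfl⟩)
    · exact vec3_mem_oddRel (Or.inr (by norm_num))) with h | h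
  · exact zero_ne_one (@h (0 : Fin 3) (1 : Fin 3) rfl)
  · have : Nat.pair 0 1 = Nat.pair 0 0 := h (1 : Fin 3) (2 : Fin 3)
    exact one_ne_zero (Nat.pair_eq_pair.1 this).2

theorem exists_binary_of_notMem_Pol_oddRel {C : Set Op} (hC : IsNeqClone C) {n : ℕ}
    {f : (Fin n → ℕ) → ℕ} (hf : f ∈ fragment C n) (hfn : (⟨n, f⟩ : Op) ∉ Pol {oddRel}) :
    ∃ g ∈ fragment C 2, g ![0, 0] = g ![0, 1] ∧ g ![0, 0] ≠ g ![0, 2] := by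
  obtain ⟨r, hr, hcon⟩ : ∃ r : Fin n → Fin 3 → ℕ,
      (∀ i, Injective (r i) ∨ ∀ j k, r i j = r i k) ∧
      ¬ (Injective (fun j => f fun i => r i j) ∨
        ∀ j k, (f fun i => r i j) = f fun i => r i k) := by
    by_contra! H
    refine hfn ⟨hC.pos _ hf, ?_⟩
    rintro _ rfl r hr
    exact H r hr
  obtain ⟨h1, h2⟩ := not_or.1 hcon
  simp only [Injective, not_forall] at h1
  obtain ⟨j, k, hjk, hne⟩ := h1
  obtain ⟨l, hl⟩ : ∃ l, (f fun i => r i j) ≠ f fun i => r i l := by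
    by_contra! H
    exact h2 fun a b => (H a).symm.trans (H b)
  have hlj : j ≠ l := fun e => hl (by rw [e])
  have hlk : k ≠ l := fun e => hl (by rw [hjk, e])
  let P : Fin 3 → Fin 2 → ℕ := ![![0, 0], ![0, 1], ![0, 2]]
  have hP0 : ![0, 0, 0] ∈ tuples C P := by
    convert hC.proj_mem_tuples P 0 using 1
    funext k
    fin_cases k <;> rfl
  have hP1 : ![0, 1, 2] ∈ tuples C P := by
    convert hC.proj_mem_tuples P 1 using 1
    funext k
    fin_cases k <;> rfl
  have hrow : ∀ i, ![r i j, r i k, r i l] ∈ tuples C P := fun i => by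
    rcases hr i with h | h
    · exact ker_mem_tuples hC.toIsClone hC.perms hP1
        (vec3_ker (iff_of_false (by norm_num) (h.ne hne)) (iff_of_false (by norm_num) (h.ne hlj))
          (iff_of_false (by norm_num) (h.ne hlk)))
    · exact ker_mem_tuples hC.toIsClone hC.perms hP0
        (vec3_ker (iff_of_true rfl (h _ _)) (iff_of_true rfl (h _ _)) (iff_of_true rfl (h _ _)))
  obtain ⟨g, hg, hgt⟩ := hC.op_mem_tuples hf hrow
  have e0 : g ![0, 0] = f fun i => r i j := hgt 0
  have e1 : g ![0, 1] = f fun i => r i k := hgt 1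
  have e2 : g ![0, 2] = f fun i => r i l := hgt 2
  exact ⟨g, hg, by rw [e0, e1, hjk], by rw [e0, e2]; exact hl⟩

/-! ### Merging values inside one slice. -/

theorem exists_perm_merging {k : ℕ → ℕ} (h1 : k 0 = k 1) (h2 : k 0 ≠ k 2) {v w x y : ℕ}
    (hvw : v ≠ w) (hxy : x ≠ y) (h : ¬ ((x = v ∨ x = w) ∧ (y = v ∨ y = w))) :
    ∃ e : ℕ → ℕ, Bijective e ∧ k (e v) = k (e w) ∧ k (e x) ≠ k (e y) := by
  have one_in : ∀ {z : ℕ}, z ≠ v → z ≠ w → ∃ e : ℕ → ℕ, Bijective e ∧ e v = 0 ∧ e w = 1 ∧ e z = 2 :=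
    fun {z} hv hw => by
      obtain ⟨e, he, hes⟩ := exists_perm_of_ker_eq ![v, w, z] ![0, 1, 2]
        (vec3_ker (iff_of_false hvw (by norm_num)) (iff_of_false hv.symm (by norm_num))
          (iff_of_false hw.symm (by norm_num)))
      exact ⟨e, he, hes 0, hes 1, hes 2⟩
  by_cases hx : x = v ∨ x = w
  · obtain ⟨e, he, e0, e1, e2⟩ := one_in (z := y) (fun e => h ⟨hx, Or.inl e⟩)
      fun e => h ⟨hx, Or.inr e⟩
    refine ⟨e, he, by rw [e0, e1, h1], ?_⟩
    rcases hx with rfl | rfl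
    · rw [e0, e2]; exact h2
    · rw [e1, e2, ← h1]; exact h2
  by_cases hy : y = v ∨ y = w
  · obtain ⟨e, he, e0, e1, e2⟩ := one_in (z := x) (fun e => h ⟨Or.inl e, hy⟩)
      fun e => h ⟨Or.inr e, hy⟩
    refine ⟨e, he, by rw [e0, e1, h1], ?_⟩
    rcases hy with rfl | rfl
    · rw [e0, e2]; exact h2.symm
    · rw [e1, e2, ← h1]; exact h2.symm
  obtain ⟨hxv, hxw⟩ := not_or.1 hx
  obtain ⟨hyv, hyw⟩ := not_or.1 hy
  have four : ∀ {a b c d : ℕ}, a ≠ b → a ≠ c → a ≠ d → b ≠ c → b ≠ d → c ≠ d →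
      ∃ e : ℕ → ℕ, Bijective e ∧ e v = a ∧ e w = b ∧ e x = c ∧ e y = d :=
    fun {a b c d} hab hac had hbc hbd hcd => by
      obtain ⟨e, he, hes⟩ := exists_perm_of_ker_eq ![v, w, x, y] ![a, b, c, d]
        (vec4_ker (iff_of_false hvw hab) (iff_of_false (Ne.symm hxv) hac)
          (iff_of_false (Ne.symm hyv) had) (iff_of_false (Ne.symm hxw) hbc)
          (iff_of_false (Ne.symm hyw) hbd) (iff_of_false hxy hcd))
      exact ⟨e, he, hes 0, hes 1, hes 2, hes 3⟩
  -- All four points are distinct. Either `2` and some `t` are separated beside the merged pair `0,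
  -- 1`, or `k` is constant from `2` on and the merged pair moves to `3, 4`.
  by_cases ht : ∃ t, 3 ≤ t ∧ k t ≠ k 2
  · obtain ⟨t, ht3, ht⟩ := ht
    obtain ⟨e, he, e0, e1, e2, e3⟩ := four (a := 0) (b := 1) (c := 2) (d := t) (by omega) (by omega)
      (by omega) (by omega) (by omega) (by omega)
    exact ⟨e, he, by rw [e0, e1, h1], by rw [e2, e3]; exact ht.symm⟩
  · push Not at ht
    obtain ⟨e, he, e0, e1, e2, e3⟩ := four (a := 3) (b := 4) (c := 0) (d := 2) (by omega) (by omega)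
      (by omega) (by omega) (by omega) (by omega)
    exact ⟨e, he, by rw [e0, e1, ht 3 (by omega), ht 4 (by omega)], by rw [e2, e3]; exact h2⟩

section merging

variable {C : Set Op} {n : ℕ} {ι : Type*} [Finite ι] {P : ι → Fin n → ℕ}

theorem exists_merge (hC : IsNeqClone C) (hn : ¬ C ⊆ hornClone) {g : (Fin 2 → ℕ) → ℕ}
    (hg : g ∈ fragment C 2) (hg1 : g ![0, 0] = g ![0, 1]) (hg2 : g ![0, 0] ≠ g ![0, 2])
    {U t : ι → ℕ} (hU : U ∈ tuples C P) (ht : t ∈ tuples C P) (c : ℕ) {v w : ℕ} (hvw : v ≠ w) :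
    ∃ s ∈ tuples C P, ∀ a b, s a = s b ↔ U a = U b ∧ (U a ≠ c ∨ t a = t b ∨
      ((t a = v ∨ t a = w) ∧ (t b = v ∨ t b = w))) := by
  have hH : hornClone ⊆ C := hornClone_subset_of_not_subset hC fun h =>
    hn (h.trans (cl_injections_subset isNeqClone_hornClone))
  refine exists_ker_eq hC hH ⟨U, hU, fun a b h => h.1⟩ fun p q hpq => ?_
  by_cases hUpq : U p = U q
  swap
  · exact ⟨U, hU, fun a b h => h.1, hUpq⟩
  simp only [hUpq, true_and, not_or, not_not] at hpq
  obtain ⟨hqc, htpq, hmerge⟩ := hpq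
  obtain ⟨γ, hγ, hγ1, hγ2⟩ := exists_perm_merging (k := fun y => g ![0, y]) hg1 hg2 hvw htpq hmerge
  have hmem := binary_mem_tuples hC.toIsClone hg
    (perm_mem_tuples hC hU (Equiv.swap c 0).bijective) (perm_mem_tuples hC ht hγ)
  -- Nothing is known of `g` for a nonzero first argument, so all classes other than `c`, which the
  -- swap moves to `0`, are collapsed.
  obtain ⟨s, hs, hsk⟩ := collapse_mem_tuples hC hn {x | x ≠ c} hU hmem
  refine ⟨s, hs, fun a b hab => (hsk a b).2 ⟨hab.1, ?_⟩, fun h => ?_⟩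
  · rw [← hab.1]
    by_cases hac : U a = c
    · right
      rcases hab.2 with h | h | ⟨h, h'⟩
      · exact absurd hac h
      · rw [h]
      · rw [hac, Equiv.swap_apply_left]
        rcases h with h | h <;> rcases h' with h' | h' <;> rw [h, h'] <;>
          first | exact hγ1 | exact hγ1.symm
    · exact Or.inl hac
  · rcases ((hsk p q).1 h).2 with h | h
    · exact h (hUpq.trans hqc)
    · simp only [hUpq, hqc, Equiv.swap_apply_left] at h
      exact hγ2 h

/-- Any equivalence relation on a single class of `U` can be realised as a kernel. -/
theorem exists_ker_on_slice (hC : IsNeqClone C) (hn : ¬ C ⊆ hornClone) {g : (Fin 2 → ℕ) → ℕ}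
    (hg : g ∈ fragment C 2) (hg1 : g ![0, 0] = g ![0, 1]) (hg2 : g ![0, 0] ≠ g ![0, 2])
    {U t : ι → ℕ} (hU : U ∈ tuples C P) (ht : t ∈ tuples C P) (c : ℕ) (F : ι → ℕ)
    (htF : ∀ a b, U a = c → U b = c → t a = t b → F a = F b) :
    ∃ s ∈ tuples C P, ∀ a b, U a = c → U b = c → (s a = s b ↔ F a = F b) := by
  induction hk : {p : ι × ι | U p.1 = c ∧ U p.2 = c ∧ F p.1 = F p.2 ∧ t p.1 ≠ t p.2}.ncard
    using Nat.strong_induction_on generalizing t with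
  | _ k ih =>
    by_cases hex : ∃ a b, U a = c ∧ U b = c ∧ F a = F b ∧ t a ≠ t b
    swap
    · push Not at hex
      exact ⟨t, ht, fun a b ha hb => ⟨htF a b ha hb, hex a b ha hb⟩⟩
    obtain ⟨p, q, hp, hq, hF, hpq⟩ := hex
    obtain ⟨s, hs, hsk⟩ := exists_merge hC hn hg hg1 hg2 hU ht c hpq
    refine ih _ ?_ hs (fun a b ha hb hab => ?_) rfl
    · rw [← hk]
      refine Set.ncard_lt_ncard ⟨fun x hx => ⟨hx.1, hx.2.1, hx.2.2.1, fun e => hx.2.2.2 ?_⟩,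
        fun hsub => ?_⟩ (Set.toFinite _)
      · exact (hsk _ _).2 ⟨hx.1.trans hx.2.1.symm, Or.inr (Or.inl e)⟩
      · exact (hsub (show (p, q) ∈ _ from ⟨hp, hq, hF, hpq⟩)).2.2.2
          ((hsk _ _).2 ⟨hp.trans hq.symm, Or.inr (Or.inr ⟨Or.inl rfl, Or.inr rfl⟩)⟩)
    · have hval : ∀ x, U x = c → (t x = t p ∨ t x = t q) → F x = F p := fun x hx h => by
        rcases h with h | h
        · exact htF _ _ hx hp h
        · exact (htF _ _ hx hq h).trans hF.symm
      rcases ((hsk a b).1 hab).2 with h | h | ⟨h, h'⟩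
      · exact absurd ha h
      · exact htF a b ha hb h
      · exact (hval a ha h).trans (hval b hb h').symm

end merging

/-- Points of different slices in the injective direction are never identified, so the kernel is an
intersection of kernels that are arbitrary on one slice and collapse all others. -/
theorem richardClone_subset {C : Set Op} (hC : IsNeqClone C) (h : ¬ C ⊆ Pol {oddRel}) :
    richardClone ⊆ C := by
  obtain ⟨⟨m, q⟩, hq, hqn⟩ := Set.not_subset.1 h
  have hn : ¬ C ⊆ hornClone := fun h' => h (h'.trans hornClone_subset_Pol_oddRel)
  have hH : hornClone ⊆ C := hornClone_subset_of_not_subset hC fun h =>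
    hn (h.trans (cl_injections_subset isNeqClone_hornClone))
  obtain ⟨g, hg, hg1, hg2⟩ := exists_binary_of_notMem_Pol_oddRel hC hq hqn
  rintro ⟨n, F⟩ ⟨i, hi⟩
  change Fin n at i
  have hFi : ∀ a b : Fin n → ℕ, F a = F b → a i = b i := fun a b hab => by
    by_contra hne
    exact hi a b hne hab
  refine mem_of_ker hC.toIsLocalClone hC.perms fun A => ?_
  have hU := hC.proj_mem_tuples (fun a : A => a.1) i
  refine exists_ker_eq hC hH ⟨_, hU, fun a b h => hFi a b h⟩ fun u v huv => ?_
  by_cases hUuv : u.1 i = v.1 i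
  swap
  · exact ⟨_, hU, fun a b h => hFi a b h, hUuv⟩
  obtain ⟨p, hp⟩ := exists_injective_nat (Fin n → ℕ)
  -- An injective tuple is the finest start, from which merging reaches the kernel of `F` on the
  -- slice of `u`.
  have ht : (fun a : A => p a) ∈ tuples C (fun a : A => a.1) :=
    ⟨p, hH (mem_hornClone_of_injective (by have := i.2; omega) hp), fun _ => rfl⟩
  obtain ⟨t, htm, htk⟩ := exists_ker_on_slice hC hn hg hg1 hg2 hU ht (u.1 i) (fun a => F a)
    fun a b _ _ hab => by rw [hp hab]
  obtain ⟨s, hs, hsk⟩ := collapse_mem_tuples hC hn {x | x ≠ u.1 i} hU htm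
  refine ⟨s, hs, fun a b hab => (hsk a b).2 ⟨hFi a b hab, ?_⟩, fun h => ?_⟩
  · by_cases ha : a.1 i = u.1 i
    · exact Or.inr ((htk a b ha ((hFi a b hab).symm.trans ha)).2 hab)
    · exact Or.inl ha
  · rcases ((hsk u v).1 h).2 with h | h
    · exact h rfl
    · exact huv ((htk u v rfl hUuv.symm).1 h)

theorem subset_oddClone_or {C : Set Op} (hC : IsNeqClone C) :
    C ⊆ oddClone ∨ richardClone ⊆ C := by
  by_cases h : C ⊆ Pol {oddRel}
  · left
    rw [oddClone_eq]
    exact Set.subset_inter h hC.neq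
  · exact Or.inr (richardClone_subset hC h)

/-! ### Operations and relations indexed by finite types -/

/-- The relation given by a set of tuples that are indexed by a finite type. -/
noncomputable def relOf {W : Type*} [Finite W] (S : Set (W → ℕ)) : Rel :=
  ⟨Nat.card W, {a | (fun w => a (Finite.equivFin W w)) ∈ S}⟩

/-- The operation given by a function whose arguments are indexed by a finite type. -/
noncomputable def opOf {I : Type*} [Finite I] (f : (I → ℕ) → ℕ) : Op :=
  ⟨Nat.card I, fun x => f fun i => x (Finite.equivFin I i)⟩

theorem preserves_relOf {W : Type*} [Finite W] {S : Set (W → ℕ)} {f : Op}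
    (h : ∀ r : Fin f.1 → W → ℕ, (∀ i, r i ∈ S) → (fun w => f.2 fun i => r i w) ∈ S) :
    Preserves f (relOf S) :=
  fun r hr => h (fun i w => r i (Finite.equivFin W w)) hr

theorem preserves_opOf_relOf {I W : Type*} [Finite I] [Finite W] {S : Set (W → ℕ)}
    {f : (I → ℕ) → ℕ} : Preserves (opOf f) (relOf S) ↔
      ∀ r : I → W → ℕ, (∀ i, r i ∈ S) → (fun w => f fun i => r i w) ∈ S := by
  constructor
  · intro h r hr
    have := h (fun i j => r ((Finite.equivFin I).symm i) ((Finite.equivFin W).symm j))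
      fun i => by
        change (fun w => r _ ((Finite.equivFin W).symm (Finite.equivFin W w))) ∈ S
        simpa using hr _
    change (fun w => f fun i => r ((Finite.equivFin I).symm (Finite.equivFin I i))
      ((Finite.equivFin W).symm (Finite.equivFin W w))) ∈ S at this
    simpa using this
  · exact fun h => preserves_relOf fun r hr => h (fun i => r (Finite.equivFin I i)) fun i => hr _

theorem opOf_mem_Pol_neq {I : Type*} [Finite I] [Nonempty I] {f : (I → ℕ) → ℕ}
    (hf : ∀ a b : I → ℕ, (∀ i, a i ≠ b i) → f a ≠ f b) : opOf f ∈ Pol {neqRel} :=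
  mem_Pol_neq.2 ⟨Nat.card_pos, fun _ _ hab => hf _ _ fun _ => hab _⟩

/-! ### Relations given by cycles -/

/-- Tuples of pairs, indexed by the vertices of a cycle, such that some pair is not constant and
pairs at different non-adjacent vertices are disjoint. -/
def cycleSet (q : ℕ) (X : Type*) : Set (ZMod q × Bool → X) :=
  {x | (∃ l, x (l, false) ≠ x (l, true)) ∧
    ∀ k l b c, x (k, b) = x (l, c) → k = l ∨ k = l + 1 ∨ l = k + 1}

/-- The conditions only demand inequalities, so they survive refining the kernel. Hence operations
injective in one direction preserve them. -/
theorem cycleSet_of_ker_le {q : ℕ} {X Y : Type*} {x : ZMod q × Bool → X} {y : ZMod q × Bool → Y}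
    (hx : x ∈ cycleSet q X) (h : ∀ v w, y v = y w → x v = x w) : y ∈ cycleSet q Y := by
  obtain ⟨⟨l, hl⟩, h2⟩ := hx
  exact ⟨⟨l, fun e => hl (h _ _ e)⟩, fun k l b c e => h2 k l b c (h _ _ e)⟩

theorem cycleSet_of_fst {q : ℕ} {x : ZMod q × Bool → ZMod q × Bool} {l : ZMod q}
    (hl : x (l, false) ≠ x (l, true)) (h : ∀ w, (x w).1 = w.1) :
    x ∈ cycleSet q (ZMod q × Bool) :=
  ⟨⟨l, hl⟩, fun k l b c e => Or.inl (by have := congrArg Prod.fst e; rwa [h, h] at this)⟩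

/-- Injective maps between cycles that preserve adjacency exist only if the lengths agree. -/
theorem eq_of_cycle_embedding {p q : ℕ} (hp : 3 ≤ p) (hq : 3 ≤ q) {σ : ZMod p → ZMod q}
    (hσ : Injective σ)
    (hadj : ∀ k, σ k = σ (k + 1) ∨ σ k = σ (k + 1) + 1 ∨ σ (k + 1) = σ k + 1) : p = q := by
  have : NeZero p := ⟨by omega⟩
  have : NeZero q := ⟨by omega⟩
  have h1 : (1 : ZMod p) ≠ 0 := by
    intro h
    have h' : ((1 : ℕ) : ZMod p) = 0 := by exact_mod_cast h
    have := Nat.le_of_dvd one_pos ((ZMod.natCast_eq_zero_iff 1 p).1 h')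
    omega
  have h2 : (2 : ZMod p) ≠ 0 := by
    intro h
    have h' : ((2 : ℕ) : ZMod p) = 0 := by exact_mod_cast h
    have := Nat.le_of_dvd two_pos ((ZMod.natCast_eq_zero_iff 2 p).1 h')
    omega
  have hle : p ≤ q := by
    simpa [ZMod.card] using Fintype.card_le_of_injective σ hσ
  have hstep : ∀ k, σ (k + 1) = σ k + 1 ∨ σ (k + 1) = σ k + -1 := fun k => by
    rcases hadj k with h | h | h
    · exact absurd (hσ h) (by simpa using h1)
    · right; rw [h]; ring
    · exact Or.inl h
  obtain ⟨e, he, he0⟩ : ∃ e : ZMod q, (e = 1 ∨ e = -1) ∧ σ (0 + 1) = σ 0 + e := by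
    rcases hstep 0 with h | h
    · exact ⟨1, Or.inl rfl, h⟩
    · exact ⟨-1, Or.inr rfl, h⟩
  have hconst : ∀ m : ℕ, σ (m + 1) = σ m + e := by
    intro m
    induction m with
    | zero => simpa using he0
    | succ m ih =>
      push_cast
      by_contra hne
      -- A change of direction would return to the vertex just left, against injectivity since `2 ≠
      -- 0`.
      have hback : σ (m + 1 + 1) = σ m := by
        rcases hstep (m + 1) with h | h <;> rcases he with rfl | rfl
        · exact absurd h hne
        · rw [h, ih]; ring
        · rw [h, ih]; ring
        · exact absurd h hne
      have := hσ hback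
      refine h2 ?_
      have h3 : (m : ZMod p) + 1 + 1 = m + 2 := by ring
      rw [h3] at this
      simpa using this
  have hlin : ∀ m : ℕ, σ m = σ 0 + m * e := by
    intro m
    induction m with
    | zero => simp
    | succ m ih =>
      push_cast
      rw [hconst, ih]
      ring
  -- Going once around the first cycle shows that `q` divides `p`, while injectivity gives `p ≤ q`.
  have hpe := hlin p
  rw [ZMod.natCast_self] at hpe
  have hp0 : ((p : ℕ) : ZMod q) = 0 := by
    rcases he with rfl | rfl <;> simpa using hpe
  exact hle.antisymm (Nat.le_of_dvd (by omega) ((ZMod.natCast_eq_zero_iff p q).1 hp0))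

section cycleOp

/-- The coordinates of the operation that separates one cycle relation from all others. -/
abbrev CycleCoord (q : ℕ) : Type :=
  {c : ZMod q × Bool → ZMod q × Bool // c ∈ cycleSet q (ZMod q × Bool)}

variable (q : ℕ)

theorem id_mem_cycleSet : (id : ZMod q × Bool → ZMod q × Bool) ∈ cycleSet q (ZMod q × Bool) :=
  cycleSet_of_fst (l := 0) (by simp) fun _ => rfl

instance : Nonempty (CycleCoord q) := ⟨⟨id, id_mem_cycleSet q⟩⟩

variable [NeZero q]

/-- The argument at which the coordinate `c` takes the value encoding `c w`. -/
noncomputable def cycleCol (w : ZMod q × Bool) : CycleCoord q → ℕ :=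
  fun c => (exists_injective_nat (ZMod q × Bool)).choose (c.1 w)

theorem cycleCol_apply_eq {w w' : ZMod q × Bool} {c : CycleCoord q} :
    cycleCol q w c = cycleCol q w' c ↔ c.1 w = c.1 w' :=
  (exists_injective_nat (ZMod q × Bool)).choose_spec.eq_iff

theorem cycleCol_injective : Injective (cycleCol q) := fun _ _ h =>
  (cycleCol_apply_eq q (c := ⟨id, id_mem_cycleSet q⟩)).1 (congrFun h _)

/-- There is an operation that identifies exactly the two columns of each vertex. -/
theorem exists_cycleOp : ∃ f : (CycleCoord q → ℕ) → ℕ, ∀ y z, f y = f z ↔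
    y = z ∨ ∃ l b c, y = cycleCol q (l, b) ∧ z = cycleCol q (l, c) := by
  classical
  obtain ⟨p, hp⟩ := exists_injective_nat (CycleCoord q → ℕ)
  let r : (CycleCoord q → ℕ) → (CycleCoord q → ℕ) := fun y =>
    if h : ∃ l b, y = cycleCol q (l, b) then cycleCol q (h.choose, false) else y
  have hcol : ∀ l b, r (cycleCol q (l, b)) = cycleCol q (l, false) := fun l b => by
    have h : ∃ l' b', cycleCol q (l, b) = cycleCol q (l', b') := ⟨l, b, rfl⟩
    obtain ⟨b', hb'⟩ := h.choose_spec
    have := (Prod.ext_iff.1 (cycleCol_injective q hb')).1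
    simp only [r]
    rw [dif_pos h, ← show l = h.choose from this]
  have hnot : ∀ y, (¬ ∃ l b, y = cycleCol q (l, b)) → r y = y := fun y h => dif_neg h
  refine ⟨fun y => p (r y), fun y z => ?_⟩
  rw [hp.eq_iff]
  constructor
  · intro h
    by_cases hy : ∃ l b, y = cycleCol q (l, b)
    · obtain ⟨l, b, rfl⟩ := hy
      rw [hcol] at h
      by_cases hz : ∃ l b, z = cycleCol q (l, b)
      · obtain ⟨l', b', rfl⟩ := hz
        rw [hcol] at h
        obtain rfl := (Prod.ext_iff.1 (cycleCol_injective q h)).1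
        exact Or.inr ⟨_, b, b', rfl, rfl⟩
      · rw [hnot z hz] at h
        exact absurd ⟨l, false, h.symm⟩ hz
    · rw [hnot y hy] at h
      by_cases hz : ∃ l b, z = cycleCol q (l, b)
      · obtain ⟨l', b', rfl⟩ := hz
        rw [hcol] at h
        exact absurd ⟨l', false, h⟩ hy
      · rw [hnot z hz] at h
        exact Or.inl h
  · rintro (rfl | ⟨l, b, c, rfl, rfl⟩)
    · rfl
    · rw [hcol, hcol]

end cycleOp

/-- The relation of all tuples in `cycleSet`. -/
noncomputable def cycleRel (q : ℕ) [NeZero q] : Rel := relOf (cycleSet q ℕ)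

theorem richardClone_preserves_cycleRel (q : ℕ) [NeZero q] {f : Op} (hf : f ∈ richardClone) :
    Preserves f (cycleRel q) := by
  obtain ⟨i, hi⟩ := hf
  refine preserves_relOf fun r hr => cycleSet_of_ker_le (hr i) fun v w h => ?_
  by_contra hne
  exact hi _ _ hne h

/-- There is an operation that preserves inequality and all cycle relations but one. -/
theorem exists_separating_cycleOp (q : ℕ) [NeZero q] (hq : 3 ≤ q) :
    ∃ f ∈ Pol {neqRel}, ¬ Preserves f (cycleRel q) ∧
      ∀ (q' : ℕ) [NeZero q'], 3 ≤ q' → q' ≠ q → Preserves f (cycleRel q') := by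
  classical
  obtain ⟨f, hf⟩ := exists_cycleOp q
  have h1 : (1 : ZMod q) ≠ 0 := by
    intro h
    have h' : ((1 : ℕ) : ZMod q) = 0 := by exact_mod_cast h
    have := Nat.le_of_dvd one_pos ((ZMod.natCast_eq_zero_iff 1 q).1 h')
    omega
  have hneq : ∀ y z : CycleCoord q → ℕ, f y = f z → ∃ c, y c = z c := by
    intro y z h
    rcases (hf y z).1 h with rfl | ⟨l, b, b', rfl, rfl⟩
    · exact ⟨⟨id, id_mem_cycleSet q⟩, rfl⟩
    -- This coordinate merges the pair at `l` only, so the two identified columns agree there; the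
    -- pair at `l + 1` stays nonconstant.
    · refine ⟨⟨fun w => if w.1 = l then (l, false) else w,
        cycleSet_of_fst (l := l + 1) (by simp [h1]) fun w => ?_⟩, ?_⟩
      · split_ifs with hw
        · exact hw.symm
        · rfl
      · rw [cycleCol_apply_eq]
        simp
  refine ⟨opOf f, opOf_mem_Pol_neq fun a b hab h => ?_, fun h => ?_, fun q' _ hq' hne => ?_⟩
  · obtain ⟨c, hc⟩ := hneq a b h
    exact hab c hc
  -- Every coordinate reads a tuple of the relation, but `f` makes every pair constant.
  · obtain ⟨⟨l, hl⟩, -⟩ := preserves_opOf_relOf.1 h (fun c w => cycleCol q w c) fun c =>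
      cycleSet_of_ker_le c.2 fun v w h => (cycleCol_apply_eq q).1 h
    exact hl ((hf _ _).2 (Or.inr ⟨l, false, true, rfl, rfl⟩))
  · refine preserves_opOf_relOf.2 fun s hs => ⟨?_, fun k l b c h => ?_⟩
    swap
    · obtain ⟨i, hi⟩ := hneq _ _ h
      exact (hs i).2 k l b c hi
    by_contra! hcon
    have hex : ∀ k : ZMod q, ∃ l β, (fun i => s i (l, β)) = cycleCol q (k, false) ∧
        (fun i => s i (l, !β)) = cycleCol q (k, true) := by
      intro k
      -- Only the pair at `k` is nonconstant in this coordinate, so the vertex `l` where row `c` is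
      -- nonconstant must carry the two columns of `k`.
      let c : CycleCoord q := ⟨fun w => if w.1 = k then w else (w.1, false),
        cycleSet_of_fst (l := k) (by simp) fun w => by split_ifs <;> rfl⟩
      obtain ⟨l, hl⟩ := (hs c).1
      rcases (hf _ _).1 (hcon l) with h | ⟨k', b, b', h, h'⟩
      · exact absurd (congrFun h c) hl
      · have e1 : s c (l, false) = cycleCol q (k', b) c := congrFun h c
        have e2 : s c (l, true) = cycleCol q (k', b') c := congrFun h' c
        have hne : c.1 (k', b) ≠ c.1 (k', b') := fun e =>
          hl (by rw [e1, e2, (cycleCol_apply_eq q).2 e])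
        have hk : k' = k := by
          by_contra hk
          simp [c, hk] at hne
        subst hk
        cases b <;> cases b'
        · exact absurd rfl hne
        · exact ⟨l, false, h, h'⟩
        · exact ⟨l, true, h', h⟩
        · exact absurd rfl hne
    choose σ β hσ1 hσ2 using hex
    refine hne (eq_of_cycle_embedding (σ := σ) hq hq' (fun k k' hk => ?_) fun k => ?_).symm
    · by_cases hβ : β k = β k'
      · have := (hσ1 k).symm.trans ((congrArg₂ (fun l b i => s i (l, b)) hk hβ).trans (hσ1 k'))
        exact (Prod.ext_iff.1 (cycleCol_injective q this)).1
      · have hβ' : (!β k) = β k' := by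
          cases h : β k <;> cases h' : β k' <;> simp_all
        have := (hσ2 k).symm.trans ((congrArg₂ (fun l b i => s i (l, b)) hk hβ').trans (hσ1 k'))
        exact absurd (Prod.ext_iff.1 (cycleCol_injective q this)).2 (by simp)
    -- Gluing the neighbours `k` and `k + 1` is allowed in the `q`-cycle; row `c` then has
    -- intersecting pairs at `σ k` and `σ (k + 1)`, forcing these to be equal or adjacent.
    · let c : CycleCoord q := ⟨fun w => if w = (k + 1, false) then (k, false) else w, by
        refine ⟨⟨k, by simp [h1]⟩, fun l l' b b' e => ?_⟩
        dsimp only at e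
        split_ifs at e with h h' h'
        · exact Or.inl ((Prod.ext_iff.1 h).1.trans (Prod.ext_iff.1 h').1.symm)
        · have ha := (Prod.ext_iff.1 h).1
          have hb := (Prod.ext_iff.1 e).1
          simp only at ha hb
          exact Or.inr (Or.inl (by rw [ha, hb]))
        · have ha := (Prod.ext_iff.1 h').1
          have hb := (Prod.ext_iff.1 e).1
          simp only at ha hb
          exact Or.inr (Or.inr (by rw [ha, hb]))
        · exact Or.inl (Prod.ext_iff.1 e).1⟩
      refine (hs c).2 _ _ (β k) (β (k + 1)) ?_
      have e1 : s c (σ k, β k) = cycleCol q (k, false) c := congrFun (hσ1 k) c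
      have e2 : s c (σ (k + 1), β (k + 1)) = cycleCol q (k + 1, false) c :=
        congrFun (hσ1 (k + 1)) c
      rw [e1, e2, cycleCol_apply_eq]
      simp [c]

/-! ### Cardinalities and embeddings of the power set -/

/-- The local clone of all operations that preserve inequality and the cycle relations of
lengths `k + 3`, `k ∈ A`. -/
noncomputable def cycleClone (A : Set ℕ) : Set Op :=
  Pol ({neqRel} ∪ (fun k => cycleRel (k + 3)) '' A)

theorem cycleClone_subset_iff {A B : Set ℕ} : cycleClone A ⊆ cycleClone B ↔ B ⊆ A := by
  refine ⟨fun h k hk => ?_, fun h =>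
    Pol_anti (Set.union_subset_union_right _ (Set.image_mono h))⟩
  by_contra hkA
  obtain ⟨f, hf, hfk, hfq⟩ := exists_separating_cycleOp (k + 3) (by omega)
  refine hfk ((h (a := f) ⟨hf.1, ?_⟩).2 _ (Or.inr ⟨k, hk, rfl⟩))
  rintro _ (rfl | ⟨m, hm, rfl⟩)
  · exact hf.2 _ rfl
  · refine hfq (m + 3) (by omega) fun e => hkA ?_
    rwa [← show m = k by omega]

theorem isNeqClone_cycleClone (A : Set ℕ) : IsNeqClone (cycleClone A) ∧
    richardClone ⊆ cycleClone A := by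
  have h : richardClone ⊆ cycleClone A := fun f hf =>
    ⟨isLocalClone_richardClone.pos f hf, by
      rintro _ (rfl | ⟨m, -, rfl⟩)
      · exact (isNeqClone_richardClone.neq hf).2 _ rfl
      · exact richardClone_preserves_cycleRel _ hf⟩
  exact ⟨{ isLocalClone_Pol _ with
    perms := isNeqClone_richardClone.perms.trans h
    neq := Pol_anti Set.subset_union_left }, h⟩

theorem nonempty_orderEmbedding {p : Set Op → Prop}
    (hp : ∀ C, IsNeqClone C → richardClone ⊆ C → p C) :
    Nonempty ((Set ℕ)ᵒᵈ ↪o {C : Set Op // p C}) :=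
  ⟨OrderEmbedding.ofMapLEIff (fun A => ⟨cycleClone (OrderDual.ofDual A),
    hp _ (isNeqClone_cycleClone _).1 (isNeqClone_cycleClone _).2⟩)
    fun _ _ => cycleClone_subset_iff⟩

/-- A local clone is determined by the finite partial operations that its members extend, and there
are only countably many of these. -/
theorem mk_le_continuum {p : Set Op → Prop} (hp : ∀ C, p C → IsLocalClone C) :
    Cardinal.mk {C : Set Op // p C} ≤ Cardinal.continuum := by
  classical
  let φ : {C : Set Op // p C} → Set (Σ n, Finset ((Fin n → ℕ) × ℕ)) := fun C =>
    {l | ∃ f ∈ fragment C.1 l.1, ∀ x ∈ l.2, f x.1 = x.2}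
  have hφ : ∀ C D : {C : Set Op // p C}, φ C = φ D → C.1 ⊆ D.1 := by
    rintro C D h ⟨n, f⟩ hf
    refine isClosed_iff_local.1 ((hp _ D.2).closed n) f fun A => ?_
    have hC : (⟨n, A.image fun a => (a, f a)⟩ : Σ n, Finset ((Fin n → ℕ) × ℕ)) ∈ φ C :=
      ⟨f, hf, fun x hx => by obtain ⟨a, -, rfl⟩ := Finset.mem_image.1 hx; rfl⟩
    rw [h] at hC
    obtain ⟨g, hg, hgA⟩ := hC
    exact ⟨g, hg, fun a ha => hgA _ (Finset.mem_image_of_mem _ ha)⟩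
  refine (Cardinal.mk_le_of_injective (f := φ) fun C D h =>
    Subtype.ext ((hφ C D h).antisymm (hφ D C h.symm))).trans ?_
  rw [Cardinal.mk_set, ← Cardinal.two_power_aleph0]
  exact Cardinal.power_le_power_left two_ne_zero Cardinal.mk_le_aleph0

theorem mk_eq_continuum {p : Set Op → Prop} (hp : ∀ C, p C → IsLocalClone C)
    (hp' : ∀ C, IsNeqClone C → richardClone ⊆ C → p C) :
    Cardinal.mk {C : Set Op // p C} = Cardinal.continuum := by
  refine (mk_le_continuum hp).antisymm ?_
  obtain ⟨e⟩ := nonempty_orderEmbedding hp'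
  rw [← Cardinal.mk_set_nat]
  exact Cardinal.mk_le_of_injective (f := fun A : Set ℕ => e (OrderDual.toDual A)) fun _ _ h =>
    OrderDual.toDual.injective (e.injective h)

end EqClone

theorem theorem13 :
    -- the monoid locally generated by the permutations is the monoid of injections
    IsLeast {M : Set (ℕ → ℕ) | EqClone.IsLocalMonoid M ∧ EqClone.perms ⊆ M} EqClone.injections ∧
    -- smallest and largest element of the monoidal interval
    IsLeast (EqClone.monoidalInterval EqClone.injections)
      (EqClone.cl (EqClone.unaryOp '' EqClone.injections)) ∧
    (IsGreatest (EqClone.monoidalInterval EqClone.injections)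
        (EqClone.polMonoid EqClone.injections) ∧
      EqClone.polMonoid EqClone.injections = EqClone.Pol {EqClone.neqRel}) ∧
    -- the Horn clone
    (EqClone.IsUniqueCoverIn (EqClone.monoidalInterval EqClone.injections)
        (EqClone.cl (EqClone.unaryOp '' EqClone.injections)) EqClone.hornClone ∧
      (∀ C ∈ EqClone.monoidalInterval EqClone.injections,
        C ≠ EqClone.cl (EqClone.unaryOp '' EqClone.injections) → EqClone.hornClone ⊆ C) ∧
      (∀ p : (Fin 2 → ℕ) → ℕ, Function.Injective p →
        EqClone.gen ⟨2, p⟩ = EqClone.hornClone) ∧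
      EqClone.Inv EqClone.hornClone = {ρ | EqClone.HornDefinable ρ}) ∧
    -- the bar clone
    ((∀ (k : ℕ) (b : (Fin 2 → ℕ) → ℕ), 1 ≤ k → EqClone.IsBarFunction k b →
        EqClone.gen ⟨2, b⟩ = EqClone.barClone) ∧
      EqClone.IsUniqueCoverIn (EqClone.monoidalInterval EqClone.injections)
        EqClone.hornClone EqClone.barClone ∧
      (∀ C ∈ EqClone.monoidalInterval EqClone.injections,
        C ≠ EqClone.cl (EqClone.unaryOp '' EqClone.injections) → C ≠ EqClone.hornClone →
          EqClone.barClone ⊆ C)) ∧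
    -- the clone of operations injective in one direction, and the odd clone
    ((∀ g : (Fin 3 → ℕ) → ℕ, EqClone.IsOddGenerator g →
        EqClone.gen ⟨3, g⟩ = EqClone.oddClone) ∧
      EqClone.richardClone ∈ EqClone.monoidalInterval EqClone.injections ∧
      EqClone.oddClone ∈ EqClone.monoidalInterval EqClone.injections ∧
      ¬ EqClone.richardClone ⊆ EqClone.oddClone ∧
      ¬ EqClone.oddClone ⊆ EqClone.richardClone ∧
      (∀ C ∈ EqClone.monoidalInterval EqClone.injections,
        C ⊆ EqClone.oddClone ∨ EqClone.richardClone ⊆ C)) ∧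
    -- cardinalities, and embeddings of the power set of `ω` ordered by reverse inclusion
    (Cardinal.mk {C : Set EqClone.Op // C ∈ EqClone.monoidalInterval EqClone.injections ∧
        EqClone.richardClone ⊆ C} = Cardinal.continuum ∧
      Nonempty ((Set ℕ)ᵒᵈ ↪o {C : Set EqClone.Op // C ∈ EqClone.localInterval
        EqClone.richardClone (EqClone.polMonoid EqClone.injections)}) ∧
      Cardinal.mk {C : Set EqClone.Op // C ∈ EqClone.monoidalInterval EqClone.injections} =
        Cardinal.continuum ∧
      Nonempty ((Set ℕ)ᵒᵈ ↪o
        {C : Set EqClone.Op // C ∈ EqClone.monoidalInterval EqClone.injections}) ∧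
      Cardinal.mk {C : Set EqClone.Op // C ∈ EqClone.localClonesAbovePerms} =
        Cardinal.continuum ∧
      Nonempty ((Set ℕ)ᵒᵈ ↪o {C : Set EqClone.Op // C ∈ EqClone.localClonesAbovePerms})) := by
  refine ⟨EqClone.isLeast_injections, EqClone.isLeast_monoidalInterval,
    ⟨EqClone.isGreatest_monoidalInterval, EqClone.polMonoid_injections⟩,
    ⟨EqClone.isUniqueCoverIn_hornClone,
      fun C hC h => EqClone.hornClone_subset_of_ne (EqClone.mem_monoidalInterval.1 hC) h,
      fun p hp => EqClone.gen_injective hp, EqClone.Inv_hornClone⟩,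
    ⟨fun k b hk hb => hb.gen_eq hk, EqClone.isUniqueCoverIn_barClone,
      fun C hC h1 h2 => EqClone.barClone_subset_of_ne (EqClone.mem_monoidalInterval.1 hC) h1 h2⟩,
    ⟨fun g hg => hg.gen_eq, EqClone.mem_monoidalInterval.2 EqClone.isNeqClone_richardClone,
      EqClone.mem_monoidalInterval.2 EqClone.isNeqClone_oddClone,
      fun h => EqClone.richardClone_not_subset fun _ hf => (EqClone.oddClone_le (h hf)).1,
      EqClone.oddClone_not_subset,
      fun C hC => EqClone.subset_oddClone_or (EqClone.mem_monoidalInterval.1 hC)⟩,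
    EqClone.mk_eq_continuum (fun C hC => hC.1.1)
      fun C hC h => ⟨EqClone.mem_monoidalInterval.2 hC, h⟩,
    EqClone.nonempty_orderEmbedding fun C hC h =>
      ⟨hC.toIsLocalClone, h, EqClone.polMonoid_injections ▸ hC.neq⟩,
    EqClone.mk_eq_continuum (fun C hC => hC.1) fun C hC _ => EqClone.mem_monoidalInterval.2 hC,
    EqClone.nonempty_orderEmbedding fun C hC _ => EqClone.mem_monoidalInterval.2 hC,
    EqClone.mk_eq_continuum (fun C hC => hC.1) fun C hC _ => ⟨hC.toIsLocalClone, hC.perms⟩,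
    EqClone.nonempty_orderEmbedding fun C hC _ => ⟨hC.toIsLocalClone, hC.perms⟩⟩
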